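/- Conventions. Let $\mathcal C$ be a triangulated category that is smashing, i.e., has all small coproducts. Classes of objects are denoted $\mathcal P,\mathcal Q\subset\operatorname{Obj}\mathcal C$; $X\perp Y$ means that all morphisms from elements of $X$ to elements of $Y$ are zero, and $X^{\perp}=\{N: X\perp N\}$. A class is extension-closed if it contains $0$ and contains $B$ for any distinguished triangle $A\to B\to D\to A[1]$ such that it contains $A$ and $D$; it is smashing (resp. $\alpha$-smashing, for an infinite regular cardinal $\alpha$) if it is closed under small coproducts (resp. coproducts of fewer than $\alpha$ elements). Write $[\mathcal P\rangle$ (resp. $[\mathcal P\rangle^{\alpha}$) for the smallest extension-closed smashing (resp. $\alpha$-smashing) class containing $\mathcal P$, and $\langle\mathcal P\rangle$ (resp. $\langle\mathcal P\rangle^{\alpha}$) for the full subcategory with object class $[\bigcup_{i\in\mathbb Z}\mathcal P[i]\rangle$ (resp. $[\bigcup_{i\in\mathbb Z}\mathcal P[i]\rangle^{\alpha}$), called the ($\alpha$-)localizing subcategory generated by $\mathcal P$. The class $\mathcal P$ is class-negative (resp. $\alpha$-negative) if $\mathcal P\perp[\bigcup_{i>0}\mathcal P[i]\rangle$ (resp.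 $\mathcal P\perp[\bigcup_{i>0}\mathcal P[i]\rangle^{\alpha}$), and countably negative means $\aleph_1$-negative. A weight structure $w$ on $\mathcal C$ is a pair of retract-closed classes $\mathcal C_{w\le0},\mathcal C_{w\ge0}$ with $\mathcal C_{w\le0}\subset\mathcal C_{w\le0}[1]$, $\mathcal C_{w\ge0}[1]\subset\mathcal C_{w\ge0}$, $\mathcal C_{w\le0}\perp\mathcal C_{w\ge0}[1]$, such that each object $M$ fits into a distinguished triangle $LM\to M\to RM\to LM[1]$ with $LM\in\mathcal C_{w\le0}$, $RM\in\mathcal C_{w\ge0}[1]$. Put $\mathcal C_{w\ge i}=\mathcal C_{w\ge 0}[i]$, $\mathcal C_{w\le i}=\mathcal C_{w\le 0}[i]$; the heart is given by $\mathcal C_{w=0}=\mathcal C_{w\le0}\cap\mathcal C_{w\ge0}$; objects of $\bigcup_{i,j}(\mathcal C_{w\ge i}\cap\mathcal C_{w\le j})$ are $w$-bounded; $w$ is left non-degenerate if $\bigcap_l\mathcal C_{w\ge l}$ consists of zero objects. $w$ is ($\alpha$-)smashing if the category has the corresponding coproducts and $\mathcal C_{w\ge0}$ is ($\alpha$-)smashing.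 $w$ is class-generated by $\mathcal P$ if the category is smashing, $\mathcal C_{w\ge0}=[\bigcup_{i\ge0}\mathcal P[i]\rangle$ and $\mathcal C_{w\le0}=[\bigcup_{i\le0}\mathcal P[i]\rangle$; $\alpha$-generated is defined similarly with $\alpha$-smashing and $[-\rangle^{\alpha}$; $w$ is generated by $\mathcal P$ if $\mathcal C_{w\ge0}=(\bigcup_{i<0}\mathcal P[i])^{\perp}$. $w$ restricts to a full triangulated subcategory $\mathcal E$ if $(\mathcal C_{w\le0}\cap\operatorname{Obj}\mathcal E,\mathcal C_{w\ge0}\cap\operatorname{Obj}\mathcal E)$ is a weight structure on $\mathcal E$. An exact functor $F$ between categories with weight structures $w,v$ is left (right) weight-exact if it maps $\mathcal C_{w\le0}$ into $\mathcal D_{v\le0}$ ($\mathcal C_{w\ge0}$ into $\mathcal D_{v\ge0}$), and weight-exact if both hold. Statement. 1. (a) If $\mathcal P$ is a class-negative class of objects of $\mathcal C$ then $\langle\mathcal P\rangle$ is a retract-closed triangulated subcategory and there is a smashing weight structure on $\langle\mathcal P\rangle$ that is class-generated by $\mathcal P$. In particular, if moreover $\langle\mathcal P\rangle=\mathcal C$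 then there exists a smashing weight structure $w$ on $\mathcal C$ that is class-generated by $\mathcal P$; it is generated by $\mathcal P$, it is the only smashing weight structure on $\mathcal C$ whose heart contains $\mathcal P$, and $\mathcal C_{w=0}$ consists of all retracts of small coproducts of elements of $\mathcal P$. (b) Conversely, if a weight structure $w$ on $\mathcal C$ is class-generated by $\mathcal P$ then $\mathcal P$ is class-negative, $\langle\mathcal P\rangle=\mathcal C$, $w$ is smashing, left non-degenerate, and generated by $\mathcal P$, $\mathcal C_{w=0}$ is the class of all retracts of small coproducts of elements of $\mathcal P$, and $w$ is the only smashing weight structure on $\mathcal C$ whose heart contains $\mathcal P$. (c) Let $w$ be class-generated by $\mathcal P$, let $v$ be a weight structure on a triangulated category $\mathcal D$, and let $F:\mathcal C\to\mathcal D$ be an exact functor that respects small coproducts. Then $F$ is left weight-exact if and only if $F(\mathcal P)\subset\mathcal D_{v\le0}$. If $v$ is smashing then $F$ is right weight-exact if and only if $F(\mathcal P)\subset\mathcal D_{v\ge0}$. If $F$ is weight-exact and essentially surjective on objects then $v$ is class-generated by $F(\mathcal P)$. (d) A class $\mathcal P$ of objects of $\mathcal C$ is class-negative if and only if the class of all small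 coproducts of families of elements of $\mathcal P$ is countably negative. 2. Let $w$ be a weight structure on $\mathcal C$ that is class-generated by $\mathcal P$. For any infinite regular cardinal $\alpha$, $\langle\mathcal P\rangle^{\alpha}$ is a triangulated subcategory and $w$ restricts to an $\alpha$-smashing weight structure on it that is $\alpha$-generated by $\mathcal P$. For any infinite (not necessarily regular) cardinal $\beta$, the class $\bigcup_{\gamma\le\beta}\operatorname{Obj}\langle\mathcal P\rangle^{\gamma}$ (where $\gamma$ runs through the infinite regular cardinals not greater than $\beta$) is the object class of a triangulated subcategory, and $w$ restricts to it. 3. Let $w$ be a smashing weight structure on $\mathcal C$ and let $\mathcal C=\langle\mathcal Q\rangle$ for a class $\mathcal Q$ of objects. If all elements of $\mathcal Q$ are $w$-bounded then $w$ is class-generated by $\mathcal C_{w=0}$. If $w$ is generated by $\mathcal Q$, and for each $M\in\mathcal Q$ there exists $i_M\in\mathbb Z$ such that $\mathcal Q\perp M[i]$ for all $i>i_M$, then $w$ is class-generated by $\mathcal C_{w=0}$ as well. -/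

import Mathlib

universe t v v' u u'

open CategoryTheory CategoryTheory.Limits CategoryTheory.Pretriangulated

namespace WeightTheory

section Classes

variable {C : Type u} [Category.{v} C]

/-- A class of objects is smashing if it is closed under all coproducts indexed by small sets
(types in the universe `t`). -/
def IsSmashingClass.{t₁, v₁, u₁} {C : Type u₁} [Category.{v₁} C] (Q : ObjectProperty C) : Prop :=
  ∀ J : Type t₁, Q.IsClosedUnderColimitsOfShape (Discrete J)

/-- A class of objects is `κ`-smashing if it is closed under coproducts of families of
cardinality less than `κ`. -/
def IsCardSmashingClass (κ : Cardinal.{t}) (Q : ObjectProperty C) : Prop :=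
  ∀ J : Type t, Cardinal.mk J < κ → Q.IsClosedUnderColimitsOfShape (Discrete J)

/-- A category is `κ`-smashing if it has coproducts of all families of cardinality less
than `κ`. -/
def IsCardSmashingCategory (κ : Cardinal.{t}) (C : Type u) [Category.{v} C] : Prop :=
  ∀ J : Type t, Cardinal.mk J < κ → HasCoproductsOfShape J C

/-- The class of all small coproducts of families of elements of `P`. -/
def coproductsOf.{t₁, v₁, u₁} {C : Type u₁} [Category.{v₁} C] (P : ObjectProperty C) :
    ObjectProperty C :=
  fun X => ∃ J : Type t₁, P.colimitsOfShape (Discrete J) X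

end Classes

section Triangulated

variable {C : Type u} [Category.{v} C] [HasZeroObject C] [HasShift C ℤ] [Preadditive C]
  [∀ n : ℤ, (shiftFunctor C n).Additive] [Pretriangulated C]

/-- `P ⊥ Q`: there are no non-zero morphisms from elements of `P` to elements of `Q`. -/
def Orthogonal (P Q : ObjectProperty C) : Prop :=
  ∀ ⦃X Y : C⦄, P X → Q Y → ∀ f : X ⟶ Y, f = 0

/-- The class `⋃_{i ∈ I} P[i]` (up to isomorphism). -/
def shifts (I : Set ℤ) (P : ObjectProperty C) : ObjectProperty C :=
  fun X => ∃ i ∈ I, ∃ Y : C, P Y ∧ Nonempty (X ≅ Y⟦i⟧)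

/-- A class of objects is extension-closed if it contains `0` and, for each distinguished
triangle `A ⟶ B ⟶ D ⟶ A⟦1⟧` such that `A` and `D` belong to the class, also contains `B`. -/
structure IsExtensionClosed (Q : ObjectProperty C) : Prop where
  zero : ∀ X : C, IsZero X → Q X
  ext : ∀ T : Triangle C, T ∈ (distTriang C) → Q T.obj₁ → Q T.obj₃ → Q T.obj₂

/-- The smallest extension-closed smashing class that contains `P`. -/
def smashingClosure.{t₁, v₁, u₁} {C : Type u₁} [Category.{v₁} C] [HasZeroObject C] [HasShift C ℤ]
    [Preadditive C] [∀ n : ℤ, (shiftFunctor C n).Additive] [Pretriangulated C]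
    (P : ObjectProperty C) : ObjectProperty C :=
  fun X => ∀ Q : ObjectProperty C,
    IsExtensionClosed Q → IsSmashingClass.{t₁} Q → P ≤ Q → Q X

/-- The smallest extension-closed `κ`-smashing class that contains `P`. -/
def cardSmashingClosure (κ : Cardinal.{t}) (P : ObjectProperty C) : ObjectProperty C :=
  fun X => ∀ Q : ObjectProperty C,
    IsExtensionClosed Q → IsCardSmashingClass κ Q → P ≤ Q → Q X

/-- The class of objects of the localizing subcategory generated by `P`. -/
def localizing.{t₁, v₁, u₁} {C : Type u₁} [Category.{v₁} C] [HasZeroObject C] [HasShift C ℤ]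
    [Preadditive C] [∀ n : ℤ, (shiftFunctor C n).Additive] [Pretriangulated C]
    (P : ObjectProperty C) : ObjectProperty C :=
  smashingClosure.{t₁} (shifts Set.univ P)

/-- The class of objects of the `κ`-localizing subcategory generated by `P`. -/
def cardLocalizing (κ : Cardinal.{t}) (P : ObjectProperty C) : ObjectProperty C :=
  cardSmashingClosure κ (shifts Set.univ P)

/-- The union of the classes of objects of the `γ`-localizing subcategories generated by `P`,
where `γ` runs through infinite regular cardinals that are not greater than `β`. -/
def cardLocalizingUnion (β : Cardinal.{t}) (P : ObjectProperty C) : ObjectProperty C :=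
  fun X => ∃ γ : Cardinal.{t}, γ.IsRegular ∧ γ ≤ β ∧ cardLocalizing γ P X

/-- `P` is class-negative: `P ⊥ [⋃_{i > 0} P[i]]`, where the brackets denote the smallest
extension-closed smashing class. -/
def ClassNegative.{t₁, v₁, u₁} {C : Type u₁} [Category.{v₁} C] [HasZeroObject C] [HasShift C ℤ]
    [Preadditive C] [∀ n : ℤ, (shiftFunctor C n).Additive] [Pretriangulated C]
    (P : ObjectProperty C) : Prop :=
  Orthogonal P (smashingClosure.{t₁} (shifts (Set.Ioi 0) P))

/-- `P` is `κ`-negative. -/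
def CardNegative (κ : Cardinal.{t}) (P : ObjectProperty C) : Prop :=
  Orthogonal P (cardSmashingClosure κ (shifts (Set.Ioi 0) P))

/-- `P` is countably negative, that is, `ℵ₁`-negative. -/
def CountablyNegative.{t₁, v₁, u₁} {C : Type u₁} [Category.{v₁} C] [HasZeroObject C] [HasShift C ℤ]
    [Preadditive C] [∀ n : ℤ, (shiftFunctor C n).Additive] [Pretriangulated C]
    (P : ObjectProperty C) : Prop :=
  CardNegative (Cardinal.aleph.{t₁} 1) P

end Triangulated

/-- A weight structure on a triangulated category (homological convention): `le` is the class
`C_{w ≤ 0}` and `ge` is the class `C_{w ≥ 0}`. -/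
@[ext]
structure WeightStructure (C : Type u) [Category.{v} C] [HasZeroObject C] [HasShift C ℤ]
    [Preadditive C] [∀ n : ℤ, (shiftFunctor C n).Additive] [Pretriangulated C] where
  le : ObjectProperty C
  ge : ObjectProperty C
  le_retract : le.IsStableUnderRetracts
  ge_retract : ge.IsStableUnderRetracts
  le_shift : ∀ X : C, le X → le (X⟦(-1 : ℤ)⟧)
  ge_shift : ∀ X : C, ge X → ge (X⟦(1 : ℤ)⟧)
  orthogonal : ∀ ⦃X Y : C⦄, le X → ge Y → ∀ f : X ⟶ Y⟦(1 : ℤ)⟧, f = 0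
  decomposition : ∀ M : C, ∃ (A B : C) (f : A ⟶ M) (g : M ⟶ B⟦(1 : ℤ)⟧)
    (h : B⟦(1 : ℤ)⟧ ⟶ A⟦(1 : ℤ)⟧), le A ∧ ge B ∧ Triangle.mk f g h ∈ (distTriang C)

namespace WeightStructure

section

variable {C : Type u} [Category.{v} C] [HasZeroObject C] [HasShift C ℤ] [Preadditive C]
  [∀ n : ℤ, (shiftFunctor C n).Additive] [Pretriangulated C] (w : WeightStructure C)

/-- The class `C_{w = 0}` of objects of the heart. -/
def heart : ObjectProperty C := w.le ⊓ w.ge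

/-- The class `C_{w ≤ n} = C_{w ≤ 0}[n]`. -/
def leInt (n : ℤ) : ObjectProperty C := shifts {n} w.le

/-- The class `C_{w ≥ n} = C_{w ≥ 0}[n]`. -/
def geInt (n : ℤ) : ObjectProperty C := shifts {n} w.ge

/-- The class of `w`-bounded objects. -/
def bounded : ObjectProperty C := fun X => ∃ i j : ℤ, w.geInt i X ∧ w.leInt j X

/-- `w` is left non-degenerate: an object that belongs to `C_{w ≥ l}` for all `l` is zero. -/
def IsLeftNondegenerate : Prop := ∀ X : C, (∀ l : ℤ, w.geInt l X) → IsZero X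

/-- `w` is smashing: `C` has small coproducts and `C_{w ≥ 0}` is closed under them. -/
def IsSmashing.{t₁, v₁, u₁} {C : Type u₁} [Category.{v₁} C] [HasZeroObject C] [HasShift C ℤ]
    [Preadditive C] [∀ n : ℤ, (shiftFunctor C n).Additive] [Pretriangulated C]
    (w : WeightStructure C) : Prop :=
  HasCoproducts.{t₁} C ∧ IsSmashingClass.{t₁} w.ge

/-- `w` is `κ`-smashing. -/
def IsCardSmashing (κ : Cardinal.{t}) : Prop :=
  IsCardSmashingCategory κ C ∧ IsCardSmashingClass κ w.ge

/-- `w` is class-generated by `P`: `C` has small coproducts, `C_{w ≥ 0} = [⋃_{i ≥ 0} P[i]]` and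
`C_{w ≤ 0} = [⋃_{i ≤ 0} P[i]]` (extension-closed smashing closures). -/
def IsClassGeneratedBy.{t₁, v₁, u₁} {C : Type u₁} [Category.{v₁} C] [HasZeroObject C]
    [HasShift C ℤ] [Preadditive C] [∀ n : ℤ, (shiftFunctor C n).Additive] [Pretriangulated C]
    (w : WeightStructure C) (P : ObjectProperty C) : Prop :=
  HasCoproducts.{t₁} C ∧ w.ge = smashingClosure.{t₁} (shifts (Set.Ici 0) P) ∧
    w.le = smashingClosure.{t₁} (shifts (Set.Iic 0) P)

/-- `w` is `κ`-generated by `P`. -/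
def IsCardGeneratedBy (κ : Cardinal.{t}) (P : ObjectProperty C) : Prop :=
  IsCardSmashingCategory κ C ∧ w.ge = cardSmashingClosure κ (shifts (Set.Ici 0) P) ∧
    w.le = cardSmashingClosure κ (shifts (Set.Iic 0) P)

/-- `w` is generated by `P`: `C_{w ≥ 0}` is the right orthogonal of `⋃_{i < 0} P[i]`. -/
def IsGeneratedBy (P : ObjectProperty C) : Prop :=
  w.ge = (shifts (Set.Iio 0) P).rightOrthogonal

/-- The weight structure `w'` on the full triangulated subcategory with object class `E` is the
restriction of `w`. -/
def IsRestriction (E : ObjectProperty C) [E.IsTriangulated]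
    (w' : WeightStructure E.FullSubcategory) : Prop :=
  w'.le = w.le.inverseImage E.ι ∧ w'.ge = w.ge.inverseImage E.ι

end

section

variable {C : Type u} [Category.{v} C] [HasZeroObject C] [HasShift C ℤ] [Preadditive C]
  [∀ n : ℤ, (shiftFunctor C n).Additive] [Pretriangulated C]
  {D : Type u'} [Category.{v'} D] [HasZeroObject D] [HasShift D ℤ] [Preadditive D]
  [∀ n : ℤ, (shiftFunctor D n).Additive] [Pretriangulated D]

/-- `F` is left weight-exact: it maps `C_{w ≤ 0}` into `D_{v ≤ 0}`. -/
def LeftWeightExact (w : WeightStructure C) (v : WeightStructure D) (F : C ⥤ D) : Prop :=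
  ∀ X : C, w.le X → v.le (F.obj X)

/-- `F` is right weight-exact: it maps `C_{w ≥ 0}` into `D_{v ≥ 0}`. -/
def RightWeightExact (w : WeightStructure C) (v : WeightStructure D) (F : C ⥤ D) : Prop :=
  ∀ X : C, w.ge X → v.ge (F.obj X)

end

end WeightStructure

/-- The functor `F` respects all coproducts indexed by small sets (types in the universe `t`). -/
def RespectsCoproducts.{t₁, v₁, v₂, u₁, u₂} {C : Type u₁} [Category.{v₁} C] {D : Type u₂}
    [Category.{v₂} D] (F : C ⥤ D) : Prop :=
  ∀ J : Type t₁, PreservesColimitsOfShape (Discrete J) F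

end WeightTheory

open WeightTheory

set_option linter.unusedSectionVars false

namespace WeightTheory

/-! ### Coproducts and classes of objects closed under them. -/

section Coproducts

variable {C : Type u} [Category.{v} C]

/-! The main tool is induction over closures: a closure lies in any extension-closed class that has
the relevant coproducts and contains the generators. Left orthogonals are always such classes, so
negativity of `P` spreads to orthogonality between the closures of the shifts `≤ m` and `≥ n` of `P`
for `m < n` (`IsNegative.orthogonal`). For two such closures `A` and `B` with `A ⊥ B[1]`, the class
`A * B` of middle terms of triangles is again closed: triangles with first term in `B` and third in
`A` split, so the factors of an iterated extension can be reordered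
(`isExtensionClosed_extensionProduct`), and coproducts of distinguished triangles are distinguished
(`exists_sigma_triangle`). Each shift of `P` lies in `A` or in `B`, hence so does the whole
localizing subcategory in `A * B`: these are the weight decompositions
(`IsNegative.closure_le_extensionProduct`).

Retract-closedness comes from the Eilenberg swindle when countable coproducts are present, and from
boundedness when only finite ones are. Each half of a weight structure is an orthogonal of the
other, which gives uniqueness (`eq_of_le`); the heart is found by splitting off the lowest weight of
an object of the closure of non-negative shifts (`IsClassGeneratedBy.heart_eq`).

The deeper point is that countable negativity suffices. If `Q` is closed under coproducts, an object
of the closure of its non-negative shifts is the homotopy colimit of pieces built from `Q, ...,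
Q[n]`. These finite stages are closed under all coproducts, so a closure formed with countable
coproducts only is closed under all of them (`IsNegative.isSmashingClass_closure`). To treat all
cardinals at once, closures are taken relative to a predicate `K` on index types. -/

theorem isClosedUnderColimitsOfShape_discrete {J : Type*} {Q : ObjectProperty C}
    (h : ∀ (f : J → C) (c : Cofan f), IsColimit c → (∀ j, Q (f j)) → Q c.pt) :
    Q.IsClosedUnderColimitsOfShape (Discrete J) where
  colimitsOfShape_le := by
    rintro X ⟨p⟩
    let e : p.diag ≅ Discrete.functor (fun j => p.diag.obj ⟨j⟩) :=
      Discrete.natIso (fun _ => Iso.refl _)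
    exact h (fun j => p.diag.obj ⟨j⟩) ((Cocone.precompose e.inv).obj p.cocone)
      ((IsColimit.precomposeInvEquiv e _).symm p.isColimit) (fun j => p.prop_diag_obj ⟨j⟩)

theorem isClosedUnderColimitsOfShape_discrete' {J : Type*} [HasCoproductsOfShape J C]
    {Q : ObjectProperty C} [Q.IsClosedUnderIsomorphisms]
    (h : ∀ f : J → C, (∀ j, Q (f j)) → Q (∐ f)) :
    Q.IsClosedUnderColimitsOfShape (Discrete J) :=
  isClosedUnderColimitsOfShape_discrete fun f _ hc hf =>
    Q.prop_of_iso ((colimit.isColimit (Discrete.functor f)).coconePointUniqueUpToIso hc) (h f hf)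

theorem prop_of_isColimit_cofan {J : Type*} (Q : ObjectProperty C)
    [Q.IsClosedUnderColimitsOfShape (Discrete J)] {f : J → C} {c : Cofan f} (hc : IsColimit c)
    (hf : ∀ j, Q (f j)) : Q c.pt :=
  Q.prop_of_isColimit hc fun j => hf j.as

theorem prop_sigma {J : Type*} (Q : ObjectProperty C)
    [Q.IsClosedUnderColimitsOfShape (Discrete J)] (f : J → C) [HasCoproduct f]
    (hf : ∀ j, Q (f j)) : Q (∐ f) :=
  prop_of_isColimit_cofan Q (colimit.isColimit (Discrete.functor f)) hf

theorem isClosedUnderColimitsOfShape_of_equiv {J : Type*} {J' : Type*} (e : J ≃ J')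
    {Q : ObjectProperty C} (h : Q.IsClosedUnderColimitsOfShape (Discrete J)) :
    Q.IsClosedUnderColimitsOfShape (Discrete J') :=
  ObjectProperty.IsClosedUnderColimitsOfShape.of_equivalence (Discrete.equivalence e)

theorem hasCoproductsOfShape_nat [HasCoproducts.{t} C] : HasCoproductsOfShape ℕ C :=
  hasColimitsOfShape_of_equivalence (Discrete.equivalence (Equiv.ulift.{t, 0} (α := ℕ)))

theorem coproductsOf_of_isColimit {P : ObjectProperty C} {J : Type t} {f : J → C} {c : Cofan f}
    (hc : IsColimit c) (hf : ∀ j, P (f j)) : coproductsOf.{t} P c.pt :=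
  ⟨J, ⟨{ diag := _, ι := _, isColimit := hc, prop_diag_obj := fun j => hf j.as }⟩⟩

theorem exists_isColimit_of_coproductsOf {P : ObjectProperty C} {X : C}
    (hX : coproductsOf.{t} P X) :
    ∃ (J : Type t) (f : J → C) (ι : ∀ j, f j ⟶ X), (∀ j, P (f j)) ∧
      Nonempty (IsColimit (Cofan.mk X ι)) := by
  obtain ⟨J, ⟨p⟩⟩ := hX
  let e : p.diag ≅ Discrete.functor (fun j => p.diag.obj ⟨j⟩) :=
    Discrete.natIso (fun _ => Iso.refl _)
  refine ⟨J, fun j => p.diag.obj ⟨j⟩, fun j => p.ι.app ⟨j⟩, fun j => p.prop_diag_obj ⟨j⟩, ⟨?_⟩⟩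
  refine IsColimit.ofIsoColimit ((IsColimit.precomposeInvEquiv e _).symm p.isColimit)
    (Cocone.ext (Iso.refl _) ?_)
  rintro ⟨j⟩
  simp [e]

instance (P : ObjectProperty C) : (coproductsOf.{t} P).IsClosedUnderIsomorphisms where
  of_iso e := fun ⟨J, hJ⟩ => ⟨J, ObjectProperty.prop_of_iso _ e hJ⟩

theorem le_coproductsOf (P : ObjectProperty C) : P ≤ coproductsOf.{t} P := by
  intro X hX
  refine coproductsOf_of_isColimit (J := PUnit.{t + 1}) (f := fun _ => X)
    (c := Cofan.mk X (fun _ => 𝟙 X)) (Cofan.IsColimit.mk _ (fun s => s.inj PUnit.unit) ?_ ?_)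
    (fun _ => hX)
  · intro s j
    cases j
    simp
  · intro s m hm
    simpa using hm PUnit.unit

/-- A coproduct of coproducts is a coproduct over the sigma type of the index sets, which stays in
the same universe. -/
theorem isSmashingClass_coproductsOf (P : ObjectProperty C) :
    IsSmashingClass.{t} (coproductsOf.{t} P) := by
  intro J
  refine isClosedUnderColimitsOfShape_discrete fun f c hc hf => ?_
  choose I g ι hg hι using fun j => exists_isColimit_of_coproductsOf (hf j)
  refine coproductsOf_of_isColimit (J := Σ j, I j) (f := fun x => g x.1 x.2)
    (c := Cofan.mk c.pt (fun x => ι x.1 x.2 ≫ c.inj x.1))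
    (Cofan.IsColimit.mk _ (fun s => Cofan.IsColimit.desc hc fun j =>
      Cofan.IsColimit.desc (hι j).some fun i => s.inj ⟨j, i⟩) ?_ ?_) (fun x => hg x.1 x.2)
  · rintro s ⟨j, i⟩
    have := Cofan.IsColimit.fac (hι j).some (fun i => s.inj ⟨j, i⟩) i
    simpa using this
  · intro s m hm
    refine Cofan.IsColimit.hom_ext hc _ _ fun j =>
      Cofan.IsColimit.hom_ext (hι j).some _ _ fun i => ?_
    have := Cofan.IsColimit.fac (hι j).some (fun i => s.inj ⟨j, i⟩) i
    have h2 := hm ⟨j, i⟩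
    simp only [Cofan.mk_pt, Cofan.IsColimit.fac] at *
    simpa [this] using h2

/-- A class closed under coproducts contains the coproducts of elements of smaller classes. -/
theorem coproductsOf_le {P Q : ObjectProperty C} (hQ : IsSmashingClass.{t} Q) (h : P ≤ Q) :
    coproductsOf.{t} P ≤ Q := by
  rintro X ⟨J, hJ⟩
  have := hQ J
  exact Q.colimitsOfShape_le _ _ (ObjectProperty.colimitsOfShape_monotone _ h _ hJ)

end Coproducts

/-! ### Closures under extensions and coproducts, shifts, and negativity. -/

section Closures

variable {C : Type u} [Category.{v} C] [HasZeroObject C] [HasShift C ℤ] [Preadditive C]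
  [∀ n : ℤ, (shiftFunctor C n).Additive] [Pretriangulated C]

/-- An extension-closed class that is closed under the coproducts indexed by the types
satisfying `K`. -/
structure IsClosedClass (K : Type t → Prop) (Q : ObjectProperty C) : Prop
    extends IsExtensionClosed Q where
  coprod : ∀ J : Type t, K J → Q.IsClosedUnderColimitsOfShape (Discrete J)

/-- The smallest extension-closed class containing `P` that is closed under the coproducts indexed
by the types satisfying `K`. -/
def closure (K : Type t → Prop) (P : ObjectProperty C) : ObjectProperty C :=
  fun X => ∀ Q : ObjectProperty C, IsClosedClass K Q → P ≤ Q → Q X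

theorem smashingClosure_eq (P : ObjectProperty C) :
    smashingClosure.{t} P = closure (fun _ : Type t => True) P := by
  ext X
  exact ⟨fun h Q hQ hP => h Q hQ.1 (fun J => hQ.2 J trivial) hP,
    fun h Q h1 h2 hP => h Q ⟨h1, fun J _ => h2 J⟩ hP⟩

theorem cardSmashingClosure_eq (κ : Cardinal.{t}) (P : ObjectProperty C) :
    cardSmashingClosure κ P = closure (fun J : Type t => Cardinal.mk J < κ) P := by
  ext X
  exact ⟨fun h Q hQ hP => h Q hQ.1 hQ.2 hP, fun h Q h1 h2 hP => h Q ⟨h1, h2⟩ hP⟩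

theorem le_closure (K : Type t → Prop) (P : ObjectProperty C) : P ≤ closure K P :=
  fun X hX _ _ hP => hP X hX

theorem closure_le {K : Type t → Prop} {P Q : ObjectProperty C} (hQ : IsClosedClass K Q)
    (h : P ≤ Q) : closure K P ≤ Q :=
  fun _ hX => hX Q hQ h

theorem IsExtensionClosed.mem {Q : ObjectProperty C} (hQ : IsExtensionClosed Q) {X Y Z : C}
    {f : X ⟶ Y} {g : Y ⟶ Z} {h : Z ⟶ X⟦(1 : ℤ)⟧} (hT : Triangle.mk f g h ∈ distTriang C)
    (hX : Q X) (hZ : Q Z) : Q Y :=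
  hQ.ext _ hT hX hZ

theorem IsExtensionClosed.isClosedUnderIsomorphisms {Q : ObjectProperty C}
    (hQ : IsExtensionClosed Q) : Q.IsClosedUnderIsomorphisms where
  of_iso {X Y} e hX := by
    obtain ⟨Z, g, h, hT⟩ := distinguished_cocone_triangle e.hom
    have hZ : IsZero Z := (Triangle.isZero₃_iff_isIso₁ _ hT).2 (inferInstanceAs (IsIso e.hom))
    exact hQ.mem hT hX (hQ.zero _ hZ)

theorem isClosedClass_closure (K : Type t → Prop) (P : ObjectProperty C) :
    IsClosedClass K (closure K P) where
  zero X hX Q hQ _ := hQ.zero X hX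
  ext T hT h1 h3 Q hQ hP := hQ.ext T hT (h1 Q hQ hP) (h3 Q hQ hP)
  coprod J hJ := ⟨by
    intro X hX Q hQ hP
    have := hQ.coprod J hJ
    exact Q.colimitsOfShape_le _ _
      (ObjectProperty.colimitsOfShape_monotone _ (closure_le hQ hP) _ hX)⟩

instance (K : Type t → Prop) (P : ObjectProperty C) :
    (closure K P).IsClosedUnderIsomorphisms :=
  (isClosedClass_closure K P).isClosedUnderIsomorphisms

theorem closure_mono {K K' : Type t → Prop} {P P' : ObjectProperty C} (hK : ∀ J, K J → K' J)
    (h : P ≤ P') : closure K P ≤ closure K' P' :=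
  have hc := isClosedClass_closure K' P'
  closure_le ⟨hc.1, fun J hJ => hc.2 J (hK J hJ)⟩ (h.trans (le_closure _ _))

theorem shifts_mono {I I' : Set ℤ} {P P' : ObjectProperty C} (hI : I ⊆ I') (h : P ≤ P') :
    shifts I P ≤ shifts I' P' :=
  fun _ ⟨i, hi, Y, hY, e⟩ => ⟨i, hI hi, Y, h _ hY, e⟩

theorem shifts_obj {I : Set ℤ} {P : ObjectProperty C} {i : ℤ} (hi : i ∈ I) {X : C} (hX : P X) :
    shifts I P (X⟦i⟧) :=
  ⟨i, hi, X, hX, ⟨Iso.refl _⟩⟩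

theorem le_shifts {I : Set ℤ} (hI : (0 : ℤ) ∈ I) (P : ObjectProperty C) : P ≤ shifts I P :=
  fun X hX => ⟨0, hI, X, hX, ⟨((shiftFunctorZero C ℤ).app X).symm⟩⟩

theorem shifts_shift {I I' : Set ℤ} {n : ℤ} (h : ∀ i ∈ I, i + n ∈ I') {P : ObjectProperty C}
    {X : C} (hX : shifts I P X) : shifts I' P (X⟦n⟧) := by
  obtain ⟨i, hi, Y, hY, ⟨e⟩⟩ := hX
  exact ⟨i + n, h i hi, Y, hY,
    ⟨(shiftFunctor C n).mapIso e ≪≫ ((shiftFunctorAdd C i n).app Y).symm⟩⟩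

theorem IsClosedClass.shift {K : Type t → Prop} {Q : ObjectProperty C} (hQ : IsClosedClass K Q)
    (n : ℤ) : IsClosedClass K (Q.shift n) where
  zero X hX := hQ.zero _ ((shiftFunctor C n).map_isZero hX)
  ext T hT h1 h3 := hQ.ext _ (Triangle.shift_distinguished T hT n) h1 h3
  coprod J hJ := by
    have := hQ.coprod J hJ
    exact inferInstanceAs ((Q.inverseImage (shiftFunctor C n)).IsClosedUnderColimitsOfShape _)

/-- The objects whose shift by `n` lies in the target closure form a closed class, so only the
generators need checking. -/
theorem closure_shifts_shift {K : Type t → Prop} {I I' : Set ℤ} {n : ℤ} (h : ∀ i ∈ I, i + n ∈ I')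
    {P : ObjectProperty C} {X : C} (hX : closure K (shifts I P) X) :
    closure K (shifts I' P) (X⟦n⟧) :=
  closure_le ((isClosedClass_closure K (shifts I' P)).shift n)
    (fun _ hY => le_closure _ _ _ (shifts_shift h hY)) X hX

/-- A morphism out of a coproduct is determined by its components. There is no such argument for
morphisms into a coproduct, which is why right orthogonals are only shown to be extension-closed. -/
theorem isClosedClass_leftOrthogonal (K : Type t → Prop) (R : ObjectProperty C) :
    IsClosedClass K R.leftOrthogonal where
  zero _ hX _ _ _ := hX.eq_of_src _ _
  ext T hT h1 h3 := R.leftOrthogonal.ext_of_isTriangulatedClosed₂ T hT h1 h3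
  coprod J _ := isClosedUnderColimitsOfShape_discrete fun f c hc hf Y g hY =>
    Cofan.IsColimit.hom_ext hc _ _ fun j => by simp [hf j (c.inj j ≫ g) hY]

theorem isExtensionClosed_rightOrthogonal (R : ObjectProperty C) :
    IsExtensionClosed R.rightOrthogonal where
  zero _ hX _ _ _ := hX.eq_of_tgt _ _
  ext T hT h1 h3 := R.rightOrthogonal.ext_of_isTriangulatedClosed₂ T hT h1 h3

theorem Orthogonal.closure_left {K : Type t → Prop} {P R : ObjectProperty C}
    (h : Orthogonal P R) : Orthogonal (closure K P) R := fun X _ hX hY f =>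
  closure_le (isClosedClass_leftOrthogonal K R) (fun _ hX' _ g hY' => h hX' hY' g) X hX f hY

theorem eq_zero_of_shift_map (n : ℤ) {X Y : C} (f : X ⟶ Y) (h : f⟦n⟧' = 0) : f = 0 :=
  (shiftFunctor C n).map_injective (by rw [h, Functor.map_zero])

theorem eq_zero_of_shift_left {X Y : C} {i : ℤ} (h : ∀ f : X ⟶ Y⟦-i⟧, f = 0) (f : X⟦i⟧ ⟶ Y) :
    f = 0 := by
  refine eq_zero_of_shift_map (-i) f ?_
  have := h ((shiftFunctorCompIsoId C i (-i) (by simp)).inv.app X ≫ f⟦-i⟧')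
  rw [← cancel_epi ((shiftFunctorCompIsoId C i (-i) (by simp)).inv.app X), this, comp_zero]

theorem eq_zero_of_shift_right {X Y : C} {i : ℤ} (h : ∀ f : X⟦-i⟧ ⟶ Y, f = 0) (f : X ⟶ Y⟦i⟧) :
    f = 0 := by
  refine eq_zero_of_shift_map (-i) f ?_
  have := h (f⟦-i⟧' ≫ (shiftFunctorCompIsoId C i (-i) (by simp)).hom.app Y)
  rw [← cancel_mono ((shiftFunctorCompIsoId C i (-i) (by simp)).hom.app Y), this, zero_comp]

/-- `P ⊥ [⋃_{i > 0} P[i]]` for closures under the coproducts indexed by the types satisfying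
`K`. -/
def IsNegative (K : Type t → Prop) (P : ObjectProperty C) : Prop :=
  Orthogonal P (closure K (shifts (Set.Ioi 0) P))

theorem classNegative_iff (P : ObjectProperty C) :
    ClassNegative.{t} P ↔ IsNegative (fun _ : Type t => True) P := by
  rw [ClassNegative, smashingClosure_eq]; rfl

theorem cardNegative_iff (κ : Cardinal.{t}) (P : ObjectProperty C) :
    CardNegative κ P ↔ IsNegative (fun J : Type t => Cardinal.mk J < κ) P := by
  rw [CardNegative, cardSmashingClosure_eq]; rfl

/-- Left orthogonals are closed, so the source may be a single `X'[i]` with `i ≤ m`. Shifting by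
`-i` moves the target into the closure of strictly positive shifts, where negativity applies. -/
theorem IsNegative.orthogonal {K : Type t → Prop} {P : ObjectProperty C} (h : IsNegative K P)
    {m n : ℤ} (hmn : m < n) :
    Orthogonal (closure K (shifts (Set.Iic m) P)) (closure K (shifts (Set.Ici n) P)) := by
  apply Orthogonal.closure_left
  rintro X Y ⟨i, hi, X', hX', ⟨e⟩⟩ hY f
  rw [← cancel_epi e.inv, comp_zero]
  refine eq_zero_of_shift_left (fun g => h hX' (closure_shifts_shift ?_ hY) g) _
  intro j hj
  simp only [Set.mem_Iic, Set.mem_Ici, Set.mem_Ioi] at *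
  lia

end Closures

end WeightTheory

namespace WeightTheory

variable {C : Type u} [Category.{v} C] [HasZeroObject C] [HasShift C ℤ] [Preadditive C]
  [∀ n : ℤ, (shiftFunctor C n).Additive] [Pretriangulated C]

/-! ### Exactness of Hom along a distinguished triangle. -/

section DistinguishedTriangles

variable {X Y Z V : C} {f : X ⟶ Y} {g : Y ⟶ Z} {h : Z ⟶ X⟦(1 : ℤ)⟧}

theorem comp_zero₁₂_of_distTriang (hT : Triangle.mk f g h ∈ distTriang C) : f ≫ g = 0 :=
  comp_distTriang_mor_zero₁₂ _ hT

theorem comp_zero₃₁_of_distTriang (hT : Triangle.mk f g h ∈ distTriang C) :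
    h ≫ f⟦(1 : ℤ)⟧' = 0 :=
  comp_distTriang_mor_zero₃₁ _ hT

theorem exists_desc₂ (hT : Triangle.mk f g h ∈ distTriang C) (a : Y ⟶ V) (ha : f ≫ a = 0) :
    ∃ b : Z ⟶ V, a = g ≫ b :=
  Triangle.yoneda_exact₂ _ hT a ha

theorem exists_desc₃ (hT : Triangle.mk f g h ∈ distTriang C) (a : Z ⟶ V) (ha : g ≫ a = 0) :
    ∃ b : X⟦(1 : ℤ)⟧ ⟶ V, a = h ≫ b :=
  Triangle.yoneda_exact₃ _ hT a ha

theorem exists_desc₁ (hT : Triangle.mk f g h ∈ distTriang C) (a : X⟦(1 : ℤ)⟧ ⟶ V)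
    (ha : h ≫ a = 0) : ∃ b : Y⟦(1 : ℤ)⟧ ⟶ V, a = f⟦(1 : ℤ)⟧' ≫ b := by
  obtain ⟨b, hb⟩ : ∃ b : Y⟦(1 : ℤ)⟧ ⟶ V, a = (-f⟦(1 : ℤ)⟧') ≫ b :=
    Triangle.yoneda_exact₃ _ (rot_of_distTriang _ hT) a ha
  exact ⟨-b, by simp [hb]⟩

theorem exists_lift₂ (hT : Triangle.mk f g h ∈ distTriang C) (a : V ⟶ Y) (ha : a ≫ g = 0) :
    ∃ b : V ⟶ X, a = b ≫ f :=
  Triangle.coyoneda_exact₂ _ hT a ha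

theorem exists_lift₃ (hT : Triangle.mk f g h ∈ distTriang C) (a : V ⟶ Z) (ha : a ≫ h = 0) :
    ∃ b : V ⟶ Y, a = b ≫ g :=
  Triangle.coyoneda_exact₃ _ hT a ha

theorem exists_lift₁ (hT : Triangle.mk f g h ∈ distTriang C) (a : V ⟶ X⟦(1 : ℤ)⟧)
    (ha : a ≫ f⟦(1 : ℤ)⟧' = 0) : ∃ b : V ⟶ Z, a = b ≫ h :=
  Triangle.coyoneda_exact₁ _ hT a ha

theorem exists_hom₃ (hT : Triangle.mk f g h ∈ distTriang C) {X' Y' Z' : C} {f' : X' ⟶ Y'}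
    {g' : Y' ⟶ Z'} {h' : Z' ⟶ X'⟦(1 : ℤ)⟧} (hT' : Triangle.mk f' g' h' ∈ distTriang C)
    (a : X ⟶ X') (b : Y ⟶ Y') (hab : f ≫ b = a ≫ f') :
    ∃ c : Z ⟶ Z', g ≫ c = b ≫ g' ∧ h ≫ a⟦(1 : ℤ)⟧' = c ≫ h' :=
  complete_distinguished_triangle_morphism _ _ hT hT' a b hab

theorem distTriang_of_iso (hT : Triangle.mk f g h ∈ distTriang C) {X' Y' Z' : C} {f' : X' ⟶ Y'}
    {g' : Y' ⟶ Z'} {h' : Z' ⟶ X'⟦(1 : ℤ)⟧} (a : X ≅ X') (b : Y ≅ Y') (c : Z ≅ Z')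
    (h1 : f ≫ b.hom = a.hom ≫ f') (h2 : g ≫ c.hom = b.hom ≫ g')
    (h3 : h ≫ a.hom⟦(1 : ℤ)⟧' = c.hom ≫ h') : Triangle.mk f' g' h' ∈ distTriang C :=
  isomorphic_distinguished _ hT _ (Triangle.isoMk _ _ a b c h1 h2 h3).symm

end DistinguishedTriangles

/-! ### Coproducts of distinguished triangles. -/

section CoproductTriangle

variable {J : Type*} [HasCoproductsOfShape J C]

theorem shift_sigma_hom_ext {X : J → C} {V : C} (n : ℤ) {b b' : (∐ X)⟦n⟧ ⟶ V}
    (h : ∀ j, (Sigma.ι X j)⟦n⟧' ≫ b = (Sigma.ι X j)⟦n⟧' ≫ b') : b = b' :=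
  Cofan.IsColimit.hom_ext (isColimitCofanMkObjOfIsColimit (shiftFunctor C n) _ _
    (coproductIsCoproduct X)) _ _ h

theorem exists_shift_sigma_desc {X : J → C} {V : C} (n : ℤ) (b : ∀ j, (X j)⟦n⟧ ⟶ V) :
    ∃ b' : (∐ X)⟦n⟧ ⟶ V, ∀ j, (Sigma.ι X j)⟦n⟧' ≫ b' = b j :=
  ⟨_, Cofan.IsColimit.fac (isColimitCofanMkObjOfIsColimit (shiftFunctor C n) _ _
    (coproductIsCoproduct X)) b⟩

/-- Coproducts of distinguished triangles are distinguished. -/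
theorem exists_sigma_triangle {X Y Z : J → C} (f : ∀ j, X j ⟶ Y j) (g : ∀ j, Y j ⟶ Z j)
    (h : ∀ j, Z j ⟶ (X j)⟦(1 : ℤ)⟧) (hT : ∀ j, Triangle.mk (f j) (g j) (h j) ∈ distTriang C) :
    ∃ (g' : ∐ Y ⟶ ∐ Z) (h' : ∐ Z ⟶ (∐ X)⟦(1 : ℤ)⟧),
      Triangle.mk (Limits.Sigma.map f) g' h' ∈ distTriang C := by
  -- The cone `W` of the coproduct map receives each `Z j`; a five-lemma chase shows that it is
  -- their coproduct.
  obtain ⟨W, p, q, hW⟩ := distinguished_cocone_triangle (Limits.Sigma.map f)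
  have hc : ∀ j, ∃ i : Z j ⟶ W, g j ≫ i = Sigma.ι Y j ≫ p ∧
      h j ≫ (Sigma.ι X j)⟦(1 : ℤ)⟧' = i ≫ q := fun j =>
    exists_hom₃ (hT j) hW (Sigma.ι X j) (Sigma.ι Y j) (by simp)
  choose i hi1 hi2 using hc
  have desc : ∀ {V : C} (a : ∀ j, Z j ⟶ V), ∃ z : W ⟶ V, ∀ j, i j ≫ z = a j := by
    intro V a
    obtain ⟨z, hz⟩ := exists_desc₂ hW (Sigma.desc fun j => g j ≫ a j) (by
      refine Limits.Sigma.hom_ext _ _ fun j => ?_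
      simp [reassoc_of% comp_zero₁₂_of_distTriang (hT j)])
    have hz' : ∀ j, g j ≫ a j = Sigma.ι Y j ≫ p ≫ z := fun j => by rw [← hz]; simp
    -- `z` has the right restriction to each `Y j`, so its error on `Z j` factors through `h j`. The
    -- assembled factors, pulled back along `q`, correct `z`.
    have hb : ∀ j, ∃ b : (X j)⟦(1 : ℤ)⟧ ⟶ V, a j - i j ≫ z = h j ≫ b := fun j =>
      exists_desc₃ (hT j) (a j - i j ≫ z) (by
        rw [Preadditive.comp_sub, reassoc_of% (hi1 j), hz', sub_self])
    choose b hb using hb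
    obtain ⟨b', hb'⟩ := exists_shift_sigma_desc 1 b
    refine ⟨z + q ≫ b', fun j => ?_⟩
    rw [Preadditive.comp_add, ← reassoc_of% (hi2 j), hb', ← hb]
    abel
  have uniq : ∀ {V : C} (z : W ⟶ V), (∀ j, i j ≫ z = 0) → z = 0 := by
    intro V z hz
    obtain ⟨b, rfl⟩ : ∃ b : (∐ X)⟦(1 : ℤ)⟧ ⟶ V, z = q ≫ b :=
      exists_desc₃ hW z (by
        refine Limits.Sigma.hom_ext _ _ fun j => ?_
        rw [comp_zero, ← reassoc_of% (hi1 j), hz, comp_zero])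
    have hb : ∀ j, ∃ c : (Y j)⟦(1 : ℤ)⟧ ⟶ V,
        (Sigma.ι X j)⟦(1 : ℤ)⟧' ≫ b = (f j)⟦(1 : ℤ)⟧' ≫ c := fun j =>
      exists_desc₁ (hT j) _ (by rw [reassoc_of% (hi2 j), hz])
    choose c hc using hb
    obtain ⟨c', hc'⟩ := exists_shift_sigma_desc 1 c
    have : b = (Limits.Sigma.map f)⟦(1 : ℤ)⟧' ≫ c' := shift_sigma_hom_ext 1 fun j => by
      rw [hc, ← hc', ← Functor.map_comp_assoc, ← Functor.map_comp_assoc]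
      simp
    rw [this, reassoc_of% comp_zero₃₁_of_distTriang hW, zero_comp]
  choose d hd using @desc
  have hlim : IsColimit (Cofan.mk W i) := Cofan.IsColimit.mk _ (fun s => d fun j => s.inj j)
    (fun s j => hd _ j) (fun s m hm => by
      rw [← sub_eq_zero]
      refine uniq _ fun j => ?_
      rw [Preadditive.comp_sub, hd, sub_eq_zero]
      exact hm j)
  let e : W ≅ ∐ Z := hlim.coconePointUniqueUpToIso (coproductIsCoproduct Z)
  exact ⟨p ≫ e.hom, e.inv ≫ q, distTriang_of_iso hW (Iso.refl _) (Iso.refl _) e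
    (by simp) (by simp) (by simp)⟩

end CoproductTriangle

/-! ### Products of classes under extension, and weight decompositions. -/

section ExtensionProduct

open ObjectProperty

variable {P Q R : ObjectProperty C}

theorem IsExtensionClosed.extensionProduct_le (hR : IsExtensionClosed R) (hP : P ≤ R)
    (hQ : Q ≤ R) : P.extensionProduct Q ≤ R :=
  fun _ ⟨_, _, _, _, _, hT, h1, h3⟩ => hR.mem hT (hP _ h1) (hQ _ h3)

theorem isExtensionClosed_of_extensionProduct_le [R.IsClosedUnderIsomorphisms] [R.ContainsZero]
    (h : R.extensionProduct R ≤ R) : IsExtensionClosed R where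
  zero _ hX := R.prop_of_isZero hX
  ext _ hT h1 h3 := h _ ⟨_, _, _, _, _, hT, h1, h3⟩

theorem extensionProduct_mono {P' Q' : ObjectProperty C} (hP : P ≤ P') (hQ : Q ≤ Q') :
    P.extensionProduct Q ≤ P'.extensionProduct Q' :=
  fun _ ⟨_, _, _, _, _, hT, h1, h3⟩ => ⟨_, _, _, _, _, hT, hP _ h1, hQ _ h3⟩

/-- If `A ⊥ B⟦1⟧` then an extension of an element of `A` by an element of `B` is split. -/
theorem extensionProduct_le_swap {A B : ObjectProperty C}
    (h : ∀ ⦃X Y : C⦄, A X → B Y → ∀ f : X ⟶ Y⟦(1 : ℤ)⟧, f = 0) :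
    B.extensionProduct A ≤ A.extensionProduct B := by
  rintro X ⟨Y, Z, f, g, k, hT, hY, hZ⟩
  obtain ⟨e, -, -⟩ := exists_iso_binaryBiproduct_of_distTriang _ hT (h hZ hY k)
  refine prop_of_iso _ (e ≪≫ biprod.braiding _ _).symm ?_
  exact ⟨_, _, _, _, _, binaryBiproductTriangle_distinguished Z Y, hZ, hY⟩

/-- Associativity gives `(A * B) * (A * B) = A * (B * A) * B`. Splitting places this in `A * (A * B)
* B = (A * A) * (B * B)`, which is contained in `A * B`. -/
theorem isExtensionClosed_extensionProduct [IsTriangulated C] {A B : ObjectProperty C}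
    (hA : IsExtensionClosed A) (hB : IsExtensionClosed B)
    (h : ∀ ⦃X Y : C⦄, A X → B Y → ∀ f : X ⟶ Y⟦(1 : ℤ)⟧, f = 0) :
    IsExtensionClosed (A.extensionProduct B) := by
  have : B.ContainsZero := ⟨_, isZero_zero C, hB.zero _ (isZero_zero C)⟩
  have : A.ContainsZero := ⟨_, isZero_zero C, hA.zero _ (isZero_zero C)⟩
  have : (A.extensionProduct B).ContainsZero :=
    ⟨_, isZero_zero C, le_extensionProduct_left B _ (hA.zero _ (isZero_zero C))⟩
  apply isExtensionClosed_of_extensionProduct_le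
  rw [extensionProduct_assoc, ← extensionProduct_assoc B A B]
  refine (extensionProduct_mono le_rfl
    (extensionProduct_mono (extensionProduct_le_swap h) le_rfl)).trans ?_
  rw [extensionProduct_assoc A B B, ← extensionProduct_assoc A A]
  exact extensionProduct_mono (hA.extensionProduct_le le_rfl le_rfl)
    (hB.extensionProduct_le le_rfl le_rfl)

theorem isClosedUnderColimitsOfShape_extensionProduct {J : Type*} [HasCoproductsOfShape J C]
    (hP : P.IsClosedUnderColimitsOfShape (Discrete J))
    (hQ : Q.IsClosedUnderColimitsOfShape (Discrete J)) :
    (P.extensionProduct Q).IsClosedUnderColimitsOfShape (Discrete J) := by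
  refine isClosedUnderColimitsOfShape_discrete' fun M hM => ?_
  choose X Y f g h hT hX hY using hM
  obtain ⟨g', h', hT'⟩ := exists_sigma_triangle f g h hT
  exact ⟨_, _, _, _, _, hT', prop_sigma P X hX, prop_sigma Q Y hY⟩

theorem isClosedClass_extensionProduct [IsTriangulated C] [HasCoproducts.{t} C]
    {K : Type t → Prop} {A B : ObjectProperty C} (hA : IsClosedClass K A) (hB : IsClosedClass K B)
    (h : ∀ ⦃X Y : C⦄, A X → B Y → ∀ f : X ⟶ Y⟦(1 : ℤ)⟧, f = 0) :
    IsClosedClass K (A.extensionProduct B) :=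
  ⟨isExtensionClosed_extensionProduct hA.1 hB.1 h, fun J hJ =>
    isClosedUnderColimitsOfShape_extensionProduct (hA.2 J hJ) (hB.2 J hJ)⟩

theorem IsExtensionClosed.containsZero (hR : IsExtensionClosed R) : R.ContainsZero :=
  ⟨_, isZero_zero C, hR.zero _ (isZero_zero C)⟩

/-- Weight decompositions in the localizing subcategory generated by a negative class. -/
theorem IsNegative.closure_le_extensionProduct [IsTriangulated C] [HasCoproducts.{t} C]
    {K : Type t → Prop} (hP : IsNegative K P) (n : ℤ) :
    closure K (shifts Set.univ P) ≤
      (closure K (shifts (Set.Iic n) P)).extensionProduct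
        (closure K (shifts (Set.Ici (n + 1)) P)) := by
  have hA := isClosedClass_closure K (shifts (Set.Iic n) P)
  have hB := isClosedClass_closure K (shifts (Set.Ici (n + 1)) P)
  have := hA.containsZero
  have := hB.containsZero
  refine closure_le (isClosedClass_extensionProduct hA hB fun X Y hX hY f => ?_) ?_
  · refine hP.orthogonal (lt_add_one n) hX (closure_shifts_shift ?_ hY) f
    intro i hi
    simp only [Set.mem_Ici] at *
    lia
  · rintro X ⟨i, -, Y, hY, e⟩
    by_cases hi : i ≤ n
    · exact le_extensionProduct_left _ _ (le_closure _ _ _ ⟨i, hi, Y, hY, e⟩)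
    · refine le_extensionProduct_right _ _ (le_closure _ _ _ ⟨i, ?_, Y, hY, e⟩)
      simp only [Set.mem_Ici]
      lia

end ExtensionProduct

/-! ### Retracts in extension-closed classes. -/

section Retracts

variable {R : ObjectProperty C}

theorem exists_iso_biprod_of_retract {X M : C} (r : Retract X M) :
    ∃ Z : C, Nonempty (M ≅ X ⊞ Z) := by
  obtain ⟨Z, g, h, hT⟩ := distinguished_cocone_triangle r.i
  have : Mono r.i := mono_of_mono_fac r.retract
  obtain ⟨e, -, -⟩ := exists_iso_binaryBiproduct_of_distTriang _ hT
    (Triangle.mor₃_eq_zero_of_mono₁ _ hT this)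
  exact ⟨Z, ⟨e⟩⟩

/-- Rotating the split triangle of `X ⊞ Z` puts `X` in the middle, between `M` and `Z[1]` or between
`Z[-1]` and `M`. -/
theorem IsExtensionClosed.of_biprod (hR : IsExtensionClosed R) {ε : ℤ} (hε : ε = 1 ∨ ε = -1)
    {X Z M : C} (e : M ≅ X ⊞ Z) (hM : R M) (hZ : R (Z⟦ε⟧)) : R X := by
  have := hR.isClosedUnderIsomorphisms
  have hM' : R (Z ⊞ X) := R.prop_of_iso (e ≪≫ biprod.braiding _ _) hM
  have hM'' : R (X ⊞ Z) := R.prop_of_iso e hM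
  rcases hε with rfl | rfl
  · exact hR.ext _ (rot_of_distTriang _ (binaryBiproductTriangle_distinguished Z X)) hM' hZ
  · exact hR.ext _ (inv_rot_of_distTriang _ (binaryBiproductTriangle_distinguished X Z)) hZ hM''

/-- The complement `Z` of `X` in `M` comes first: it lies in `R` because `X[ε]` does. Then `Z[ε]`
lies in `R`, and the roles of `X` and `Z` are exchanged. -/
theorem IsExtensionClosed.of_retract_of_shift (hR : IsExtensionClosed R) {ε : ℤ}
    (hε : ε = 1 ∨ ε = -1) (hRε : ∀ Y, R Y → R (Y⟦ε⟧)) {X M : C} (r : Retract X M) (hM : R M)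
    (hX : R (X⟦ε⟧)) : R X := by
  obtain ⟨Z, ⟨e⟩⟩ := exists_iso_biprod_of_retract r
  exact hR.of_biprod hε e hM
    (hRε _ (hR.of_biprod hε (e ≪≫ biprod.braiding _ _) hM hX))

theorem IsExtensionClosed.of_retract_of_shift_nat (hR : IsExtensionClosed R) {ε : ℤ}
    (hε : ε = 1 ∨ ε = -1) (hRε : ∀ Y, R Y → R (Y⟦ε⟧)) (n : ℕ) {X M : C} (r : Retract X M)
    (hM : R M) (hX : R (X⟦(n : ℤ) * ε⟧)) : R X := by
  have := hR.isClosedUnderIsomorphisms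
  induction n generalizing X M with
  | zero => exact R.prop_of_iso ((shiftFunctorZero' C _ (by simp)).app X) hX
  | succ n ih =>
    refine hR.of_retract_of_shift hε hRε r hM (ih (r.map (shiftFunctor C ε)) (hRε _ hM) ?_)
    exact R.prop_of_iso ((shiftFunctorAdd' C ε (n * ε) _ (by push_cast; ring)).app X) hX

/-- The Eilenberg swindle: a retract of `M` is a summand of `∐ M`, with complement `∐ M`. -/
theorem nonempty_sigma_iso_biprod_of_retract [HasCoproductsOfShape ℕ C] {X M : C}
    (r : Retract X M) :
    Nonempty ((∐ fun _ : ℕ => M) ≅ X ⊞ (∐ fun _ : ℕ => M)) := by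
  let T := ∐ fun _ : ℕ => M
  let ι : ℕ → (M ⟶ T) := Sigma.ι (fun _ : ℕ => M)
  let p : M ⟶ M := r.r ≫ r.i
  have hp : p ≫ p = p := by simp [p]
  let φ : T ⟶ T := Sigma.desc fun n => p ≫ ι (n + 1) + (𝟙 M - p) ≫ ι n
  let ψ : T ⟶ T := Sigma.desc fun n => match n with
    | 0 => (𝟙 M - p) ≫ ι 0
    | n + 1 => p ≫ ι n + (𝟙 M - p) ≫ ι (n + 1)
  let q : T ⟶ X := Sigma.desc fun n => match n with
    | 0 => r.r
    | n + 1 => 0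
  have hφ : ∀ n, ι n ≫ φ = p ≫ ι (n + 1) + (𝟙 M - p) ≫ ι n := fun n => by simp [ι, φ]
  have hψ0 : ι 0 ≫ ψ = (𝟙 M - p) ≫ ι 0 := by simp [ι, ψ]
  have hψ : ∀ n, ι (n + 1) ≫ ψ = p ≫ ι n + (𝟙 M - p) ≫ ι (n + 1) := fun n => by simp [ι, ψ]
  have hq0 : ι 0 ≫ q = r.r := by simp [ι, q]
  have hq : ∀ n, ι (n + 1) ≫ q = 0 := fun n => by simp [ι, q]
  have hpr : p ≫ r.r = r.r := by simp [p]
  have hri : r.i ≫ p = r.i := by simp [p]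
  have hp' : ∀ {V : C} (x : M ⟶ V), p ≫ p ≫ x = p ≫ x := fun x => by rw [reassoc_of% hp]
  let b : BinaryBicone X T :=
    { pt := T
      fst := q
      snd := ψ
      inl := r.i ≫ ι 0
      inr := φ
      inl_fst := by simp [hq0]
      inl_snd := by simp [hψ0, Preadditive.comp_sub, Preadditive.sub_comp, reassoc_of% hri]
      inr_fst := by
        refine Limits.Sigma.hom_ext _ _ fun n => ?_
        change ι n ≫ φ ≫ q = ι n ≫ 0
        rw [reassoc_of% (hφ n)]
        cases n <;> simp [Preadditive.sub_comp, hq0, hq, hpr]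
      inr_snd := by
        refine Limits.Sigma.hom_ext _ _ fun n => ?_
        change ι n ≫ φ ≫ ψ = ι n ≫ 𝟙 _
        rw [reassoc_of% (hφ n)]
        cases n <;> simp [Preadditive.sub_comp, Preadditive.comp_sub, Preadditive.add_comp,
          Preadditive.comp_add, hψ0, hψ, hp'] }
  have hb : b.IsBilimit := isBinaryBilimitOfTotal b (by
    refine Limits.Sigma.hom_ext _ _ fun n => ?_
    change ι n ≫ (q ≫ r.i ≫ ι 0 + ψ ≫ φ) = ι n ≫ 𝟙 _
    rw [Preadditive.comp_add]
    cases n with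
    | zero =>
      rw [reassoc_of% hq0, reassoc_of% hψ0]
      simp only [hφ]
      simp [Preadditive.sub_comp, Preadditive.comp_sub, Preadditive.comp_add, hp']
      simp [p]
    | succ n =>
      rw [reassoc_of% (hq n), reassoc_of% (hψ n)]
      simp [Preadditive.sub_comp, Preadditive.comp_sub, Preadditive.add_comp,
          Preadditive.comp_add, hp', hφ])
  exact ⟨biprod.uniqueUpToIso _ _ hb⟩

theorem IsExtensionClosed.of_retract_of_nat [HasCoproductsOfShape ℕ C] (hR : IsExtensionClosed R)
    (hRN : R.IsClosedUnderColimitsOfShape (Discrete ℕ)) {ε : ℤ} (hε : ε = 1 ∨ ε = -1)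
    (hRε : ∀ Y, R Y → R (Y⟦ε⟧)) {X M : C} (r : Retract X M) (hM : R M) : R X := by
  obtain ⟨e⟩ := nonempty_sigma_iso_biprod_of_retract r
  have hT : R (∐ fun _ : ℕ => M) := prop_sigma R _ fun _ => hM
  exact hR.of_biprod hε e hT (hRε _ hT)

end Retracts

end WeightTheory

namespace WeightTheory

/-! ### Telescopes of sequences. -/

section Telescope

variable {C : Type u} [Category.{v} C] [Preadditive C] [HasCoproductsOfShape ℕ C]

/-- The endomorphism of `∐ F` given by the transition morphisms of the sequence `F`. -/
noncomputable def telescopeShift {F : ℕ → C} (τ : ∀ n, F n ⟶ F (n + 1)) : ∐ F ⟶ ∐ F :=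
  Sigma.desc fun n => τ n ≫ Sigma.ι F (n + 1)

/-- The iterates of `telescopeShift`. -/
noncomputable def telescopeShiftPow {F : ℕ → C} (τ : ∀ n, F n ⟶ F (n + 1)) : ℕ → (∐ F ⟶ ∐ F)
  | 0 => 𝟙 _
  | k + 1 => telescopeShiftPow τ k ≫ telescopeShift τ

/-- The composite transition morphisms of a sequence. -/
def transition {F : ℕ → C} (τ : ∀ n, F n ⟶ F (n + 1)) : ∀ k n : ℕ, F n ⟶ F (n + k)
  | 0, _ => 𝟙 _
  | k + 1, n => transition τ k n ≫ τ (n + k)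

section

variable {F : ℕ → C} (τ : ∀ n, F n ⟶ F (n + 1))

theorem ι_telescopeShift (n : ℕ) :
    Sigma.ι F n ≫ telescopeShift τ = τ n ≫ Sigma.ι F (n + 1) := by
  simp [telescopeShift]

theorem ι_telescopeShiftPow (k n : ℕ) :
    Sigma.ι F n ≫ telescopeShiftPow τ k = transition τ k n ≫ Sigma.ι F (n + k) := by
  induction k with
  | zero => simp [telescopeShiftPow, transition]
  | succ k ih =>
    rw [telescopeShiftPow, reassoc_of% ih, ι_telescopeShift, transition, Category.assoc]
    rfl

theorem telescopeShift_comm (k : ℕ) :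
    telescopeShift τ ≫ telescopeShiftPow τ k = telescopeShiftPow τ k ≫ telescopeShift τ := by
  induction k with
  | zero => simp [telescopeShiftPow]
  | succ k ih => rw [telescopeShiftPow, reassoc_of% ih, Category.assoc]

/-- Geometric sum: `1 - s^k = (1 + s + ... + s^(k-1)) (1 - s)`. Thus `s^k` acts as the identity on
the kernel of `1 - s` and modulo its image, so the first `k` terms of a sequence can be ignored. -/
theorem exists_sub_telescopeShiftPow (k : ℕ) :
    ∃ c : ∐ F ⟶ ∐ F, 𝟙 _ - telescopeShiftPow τ k = c ≫ (𝟙 _ - telescopeShift τ) := by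
  induction k with
  | zero => exact ⟨0, by simp [telescopeShiftPow]⟩
  | succ k ih =>
    obtain ⟨c, hc⟩ := ih
    refine ⟨𝟙 _ + c ≫ telescopeShift τ, ?_⟩
    have h : c ≫ telescopeShift τ ≫ (𝟙 _ - telescopeShift τ) =
        (𝟙 _ - telescopeShiftPow τ k) ≫ telescopeShift τ := by
      rw [hc]
      simp [Preadditive.comp_sub, Preadditive.sub_comp]
    rw [Preadditive.add_comp, Category.assoc, h, telescopeShiftPow]
    simp [Preadditive.sub_comp]

theorem comp_telescopeShiftPow {X : C} {g : X ⟶ ∐ F}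
    (hg : g ≫ (𝟙 _ - telescopeShift τ) = 0) (k : ℕ) : g ≫ telescopeShiftPow τ k = g := by
  obtain ⟨c, hc⟩ := exists_sub_telescopeShiftPow τ k
  have hs : g ≫ telescopeShift τ = g := by
    rw [Preadditive.comp_sub, Category.comp_id, sub_eq_zero] at hg
    exact hg.symm
  clear hc c
  induction k with
  | zero => simp [telescopeShiftPow]
  | succ k ih => rw [telescopeShiftPow, reassoc_of% ih, hs]

end

theorem transition_id (M : C) (k n : ℕ) :
    transition (F := fun _ => M) (fun _ => 𝟙 M) k n = 𝟙 M := by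
  induction k with
  | zero => rfl
  | succ k ih => rw [transition, ih]; exact Category.id_comp _

section

variable {F : ℕ → C} {τ : ∀ n, F n ⟶ F (n + 1)} {M : C} {φ : ∀ n, F n ⟶ M}

/-- A compatible family of morphisms `F n ⟶ M` makes the telescope of `F` compute `M` as seen by
an object `X`, provided that the tails of the induced morphism `∐ F ⟶ ∐ M` are seen as bijective
by `X`. -/
theorem telescope_exact (hφ : ∀ n, τ n ≫ φ (n + 1) = φ n) {X : C} (k : ℕ)
    (hsurj : ∀ y : X ⟶ ∐ fun _ : ℕ => M, ∃ z : X ⟶ ∐ fun n => F (n + k),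
      y = z ≫ Limits.Sigma.map fun n => φ (n + k))
    (hinj : ∀ z : X ⟶ ∐ fun n => F (n + k),
      z ≫ (Limits.Sigma.map fun n => φ (n + k)) = 0 → z = 0) :
    (∀ x : X ⟶ M, ∃ g : X ⟶ ∐ F, x = g ≫ Sigma.desc φ) ∧
    (∀ g : X ⟶ ∐ F, g ≫ Sigma.desc φ = 0 → ∃ h, g = h ≫ (𝟙 _ - telescopeShift τ)) ∧
    (∀ h : X ⟶ ∐ F, h ≫ (𝟙 _ - telescopeShift τ) = 0 → h = 0) := by
  let MM : ℕ → C := fun _ => M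
  let τM : ∀ n, MM n ⟶ MM (n + 1) := fun _ => 𝟙 M
  let s := telescopeShift τ
  let sM := telescopeShift τM
  let e := telescopeShiftPow τ k
  let eM := telescopeShiftPow τM k
  let u : ∐ F ⟶ ∐ MM := Limits.Sigma.map φ
  let w : (∐ fun n => F (n + k)) ⟶ ∐ MM := Limits.Sigma.map fun n => φ (n + k)
  -- The power `e` of the shift factors as `σ ≫ ρ` through the tail, where the hypotheses apply.
  -- They make `u` injective and surjective up to `e` and `eM`.
  let σ : ∐ F ⟶ ∐ fun n => F (n + k) := Limits.Sigma.map fun n => transition τ k n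
  let ρ : (∐ fun n => F (n + k)) ⟶ ∐ F := Sigma.desc fun n => Sigma.ι F (n + k)
  let del : ∐ MM ⟶ M := Sigma.desc fun _ => 𝟙 M
  -- For the constant sequence, `r` splits the telescope: it is a one-sided inverse of `1 - sM`, and
  -- in the other order gives the identity minus the projection to copy `0` through `del`.
  let r : ∐ MM ⟶ ∐ MM := Sigma.desc fun n => -∑ j ∈ Finset.range n, Sigma.ι MM j
  have htr : ∀ k n, transition τ k n ≫ φ (n + k) = φ n := by
    intro k n
    induction k with
    | zero => exact Category.id_comp _
    | succ k ih => exact (Category.assoc _ _ _).trans (by rw [← ih]; exact congrArg _ (hφ _))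
  have hσρ : σ ≫ ρ = e := Limits.Sigma.hom_ext _ _ fun n => by
    simp only [e, ι_telescopeShiftPow]
    simp [σ, ρ]
  have hσw : σ ≫ w = u := Limits.Sigma.hom_ext _ _ fun n => by
    simp [σ, w, u, reassoc_of% htr]
  have heM : ∀ n, Sigma.ι MM n ≫ eM = Sigma.ι MM (n + k) := fun n => by
    simp only [eM, ι_telescopeShiftPow, τM, transition_id]
    exact Category.id_comp _
  have hsM : ∀ n, Sigma.ι MM n ≫ sM = Sigma.ι MM (n + 1) := fun n => by
    simp only [sM, ι_telescopeShift, τM]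
    exact Category.id_comp _
  have hρu : ρ ≫ u = w ≫ eM := Limits.Sigma.hom_ext _ _ fun n => by
    simp [ρ, u, w, heM]
  have hus : s ≫ u = u ≫ sM := Limits.Sigma.hom_ext _ _ fun n => by
    simp only [s, reassoc_of% ι_telescopeShift]
    simp [u, hsM, reassoc_of% hφ]
  have hudel : u ≫ del = Sigma.desc φ := Limits.Sigma.hom_ext _ _ fun n => by
    simp [u, del]
    exact Category.comp_id _
  have hedel : eM ≫ del = del := Limits.Sigma.hom_ext _ _ fun n => by
    rw [reassoc_of% heM]
    simp [del]
  have hr : ∀ n, Sigma.ι MM n ≫ r = -∑ j ∈ Finset.range n, Sigma.ι MM j := fun n => by simp [r]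
  have hrs : r ≫ (𝟙 _ - sM) = 𝟙 _ - del ≫ Sigma.ι MM 0 := Limits.Sigma.hom_ext _ _ fun n => by
    have h1 : Sigma.ι MM n ≫ (𝟙 _ - del ≫ Sigma.ι MM 0) = Sigma.ι MM n - Sigma.ι MM 0 := by
      have : Sigma.ι MM n ≫ del = 𝟙 M := by simp [del]
      rw [Preadditive.comp_sub, ← Category.assoc, this, Category.comp_id]
      exact congrArg _ (Category.id_comp _)
    rw [h1, reassoc_of% hr, Preadditive.neg_comp, Preadditive.sum_comp]
    simp only [Preadditive.comp_sub, hsM, Category.comp_id]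
    rw [Finset.sum_range_sub', neg_sub]
  have hsr : (𝟙 _ - sM) ≫ r = 𝟙 _ := Limits.Sigma.hom_ext _ _ fun n => by
    rw [Preadditive.sub_comp, Preadditive.comp_sub, reassoc_of% hsM, Category.id_comp, hr, hr,
      Finset.sum_range_succ, Category.comp_id]
    abel
  have inj : ∀ h : X ⟶ ∐ F, h ≫ u = 0 → h ≫ e = 0 := fun h hh => by
    rw [← hσw] at hh
    rw [← hσρ, ← Category.assoc, hinj (h ≫ σ) (by rw [Category.assoc]; exact hh), zero_comp]
  have surj : ∀ y : X ⟶ ∐ MM, ∃ h : X ⟶ ∐ F, y ≫ eM = h ≫ u := fun y => by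
    obtain ⟨z, hz⟩ := hsurj y
    exact ⟨z ≫ ρ, by rw [Category.assoc, hρu, hz]; exact Category.assoc _ _ _⟩
  refine ⟨fun x => ?_, fun g hg => ?_, fun h hh => ?_⟩
  · obtain ⟨h, hh⟩ := surj (x ≫ Sigma.ι MM 0)
    refine ⟨h, ?_⟩
    rw [← hudel, ← reassoc_of% hh, hedel]
    simp [del]
  · rw [← hudel, ← Category.assoc] at hg
    obtain ⟨y, hy⟩ : ∃ y : X ⟶ ∐ MM, g ≫ u = y ≫ (𝟙 _ - sM) := by
      refine ⟨(g ≫ u) ≫ r, ?_⟩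
      rw [Category.assoc, hrs, Preadditive.comp_sub, ← Category.assoc (g ≫ u), hg, zero_comp,
        sub_zero, Category.comp_id]
    obtain ⟨h, hh⟩ := surj y
    have hue : e ≫ u = u ≫ eM := by rw [← hσρ, Category.assoc, hρu, reassoc_of% hσw]
    have hcomm : sM ≫ eM = eM ≫ sM := telescopeShift_comm τM k
    have hcomm' : s ≫ e = e ≫ s := telescopeShift_comm τ k
    -- `g ≫ e` and `h ≫ (1 - s)` agree after `u`, hence after a further `e`.
    have h0 : (g ≫ e - h ≫ (𝟙 _ - s)) ≫ u = 0 := by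
      have h1 : (g ≫ e) ≫ u = (g ≫ u) ≫ eM := by rw [Category.assoc, hue, Category.assoc]
      have h2 : (h ≫ (𝟙 _ - s)) ≫ u = (h ≫ u) ≫ (𝟙 _ - sM) := by
        simp [Preadditive.sub_comp, Preadditive.comp_sub, hus]
      rw [Preadditive.sub_comp, h1, h2, ← hh, hy, sub_eq_zero]
      simp only [Category.assoc, Preadditive.comp_sub, Preadditive.sub_comp, Category.comp_id,
        hcomm]
    have h1 := inj _ h0
    rw [Preadditive.sub_comp, sub_eq_zero] at h1
    obtain ⟨c, hc⟩ := exists_sub_telescopeShiftPow τ k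
    change 𝟙 _ - e = c ≫ (𝟙 _ - s) at hc
    -- Write `g = g(1 - e) + ge(1 - e) + gee`: the first two terms are multiples of `1 - s` by the
    -- geometric sum, and `gee = h(1 - s)e = he(1 - s)`.
    refine ⟨g ≫ c + (g ≫ e) ≫ c + h ≫ e, ?_⟩
    change g = _ ≫ (𝟙 _ - s)
    have h2 : (h ≫ e) ≫ (𝟙 _ - s) = (h ≫ (𝟙 _ - s)) ≫ e := by
      simp only [Category.assoc, Preadditive.comp_sub, Preadditive.sub_comp, Category.comp_id,
        hcomm']
    rw [Preadditive.add_comp, Preadditive.add_comp, h2, ← h1, Category.assoc, Category.assoc,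
      ← hc, Category.assoc]
    simp [Preadditive.comp_sub]
  · have h1 : (h ≫ u) ≫ (𝟙 _ - sM) = 0 := by
      have : (h ≫ (𝟙 _ - s)) ≫ u = 0 := by
        change h ≫ (𝟙 _ - s) = 0 at hh
        rw [hh, zero_comp]
      rw [← this]
      simp [Preadditive.sub_comp, Preadditive.comp_sub, hus]
    have h2 : h ≫ u = 0 := by
      rw [← Category.comp_id (h ≫ u), ← hsr, ← Category.assoc, h1, zero_comp]
    rw [← comp_telescopeShiftPow τ hh k]
    exact inj h h2

end

end Telescope

end WeightTheory

/-! ### Bounded pieces, homotopy colimits, and the sufficiency of countable negativity. -/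

namespace WeightTheory

variable {C : Type u} [Category.{v} C] [HasZeroObject C] [HasShift C ℤ] [Preadditive C]
  [∀ n : ℤ, (shiftFunctor C n).Additive] [Pretriangulated C]

open ObjectProperty

theorem shifts_singleton_obj (n : ℤ) {Q : ObjectProperty C} {X : C} (hX : Q X) :
    shifts {n} Q (X⟦n⟧) :=
  shifts_obj (Set.mem_singleton n) hX

theorem shifts_singleton_eq (n : ℤ) (Q : ObjectProperty C) [Q.IsClosedUnderIsomorphisms] :
    shifts {n} Q = Q.shift (-n) := by
  ext X
  constructor
  · rintro ⟨i, hi, Y, hY, ⟨e⟩⟩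
    rw [Set.mem_singleton_iff.1 hi] at e
    exact Q.prop_of_iso ((shiftFunctor C (-n)).mapIso e ≪≫
      (shiftFunctorCompIsoId C n (-n) (by simp)).app Y).symm hY
  · intro hX
    exact ⟨n, rfl, _, hX, ⟨((shiftFunctorCompIsoId C (-n) n (by simp)).app X).symm⟩⟩

theorem isClosedUnderColimitsOfShape_shifts_singleton {J : Type*} (n : ℤ) {Q : ObjectProperty C}
    [Q.IsClosedUnderIsomorphisms] (hQ : Q.IsClosedUnderColimitsOfShape (Discrete J)) :
    (shifts {n} Q).IsClosedUnderColimitsOfShape (Discrete J) := by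
  rw [shifts_singleton_eq]
  exact inferInstanceAs ((Q.inverseImage (shiftFunctor C (-n))).IsClosedUnderColimitsOfShape _)

/-- A class closed under coproducts is extension-closed if all the extensions of its elements
are split. -/
theorem isExtensionClosed_of_isSmashingClass {Q : ObjectProperty C}
    [Q.IsClosedUnderIsomorphisms] (hQ : IsSmashingClass.{t} Q)
    (h : ∀ ⦃X Y : C⦄, Q X → Q Y → ∀ f : X ⟶ Y⟦(1 : ℤ)⟧, f = 0) : IsExtensionClosed Q where
  zero X hX := by
    have := hQ PEmpty.{t + 1}
    -- A zero object is the coproduct of the empty family.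
    exact prop_of_isColimit_cofan Q (f := PEmpty.elim) (c := Cofan.mk X (fun j => j.elim))
      (Cofan.IsColimit.mk _ (fun s => 0) (fun _ j => j.elim) (fun s m _ => hX.eq_of_src _ _))
      (fun j => j.elim)
  ext T hT h1 h3 := by
    have : Q.IsClosedUnderColimitsOfShape (Discrete WalkingPair) :=
      isClosedUnderColimitsOfShape_of_equiv Equiv.ulift (hQ (ULift.{t} WalkingPair))
    obtain ⟨e, -, -⟩ := exists_iso_binaryBiproduct_of_distTriang _ hT (h h3 h1 _)
    refine Q.prop_of_iso e.symm ?_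
    exact Q.prop_of_isColimit (BinaryBiproduct.isColimit T.obj₁ T.obj₃)
      (by rintro ⟨_ | _⟩ <;> assumption)

section

variable {K : Type t → Prop} {Q : ObjectProperty C}

theorem IsNegative.eq_zero_of_shift_one (h : IsNegative K Q) ⦃X Y : C⦄ (hX : Q X) (hY : Q Y)
    (f : X ⟶ Y⟦(1 : ℤ)⟧) : f = 0 :=
  h hX (le_closure _ _ _ (shifts_obj (by simp) hY)) f

theorem IsNegative.isClosedClass (h : IsNegative K Q) [Q.IsClosedUnderIsomorphisms]
    (hQ : IsSmashingClass.{t} Q) : IsClosedClass K Q :=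
  ⟨isExtensionClosed_of_isSmashingClass hQ h.eq_zero_of_shift_one, fun J _ => hQ J⟩

/-- Cutting just above the lowest shift: since extensions inside `Q[n]` split, `Q[n]` is itself a
closed class and can serve as the lower factor without passing to its closure. -/
theorem IsNegative.closure_Ici_le [IsTriangulated C] [HasCoproducts.{t} C] (h : IsNegative K Q)
    [Q.IsClosedUnderIsomorphisms] (hQ : IsSmashingClass.{t} Q) (n : ℤ) :
    closure K (shifts (Set.Ici n) Q) ≤
      (shifts {n} Q).extensionProduct (closure K (shifts (Set.Ici (n + 1)) Q)) := by
  have hA : IsClosedClass K (shifts {n} Q) := by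
    rw [shifts_singleton_eq]
    exact (h.isClosedClass hQ).shift _
  have hB := isClosedClass_closure K (shifts (Set.Ici (n + 1)) Q)
  have := hA.containsZero
  have := hB.containsZero
  refine closure_le (isClosedClass_extensionProduct hA hB fun X Y hX hY f => ?_) ?_
  · refine h.orthogonal (lt_add_one n) (le_closure _ _ _ (shifts_mono ?_ le_rfl _ hX))
      (closure_shifts_shift ?_ hY) f
    · simp
    · intro i hi
      simp only [Set.mem_Ici] at *
      lia
  · rintro X ⟨i, hi, Y, hY, e⟩
    simp only [Set.mem_Ici] at hi
    by_cases hi' : i = n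
    · exact le_extensionProduct_left _ _ ⟨i, hi', Y, hY, e⟩
    · refine le_extensionProduct_right _ _ (le_closure _ _ _ ⟨i, ?_, Y, hY, e⟩)
      simp only [Set.mem_Ici]
      lia

/-- The class of the iterated extensions of elements of `Q`, ..., `Q⟦n⟧`. -/
def boundedLevel (Q : ObjectProperty C) : ℕ → ObjectProperty C
  | 0 => shifts {0} Q
  | n + 1 => (boundedLevel Q n).extensionProduct (shifts {(n + 1 : ℤ)} Q)

/-- This holds for all small coproducts, not only those allowed by `K`; the finite stages are
introduced for this reason. -/
theorem isSmashingClass_boundedLevel [HasCoproducts.{t} C] [Q.IsClosedUnderIsomorphisms]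
    (hQ : IsSmashingClass.{t} Q) (n : ℕ) : IsSmashingClass.{t} (boundedLevel Q n) := fun J => by
  induction n with
  | zero => exact isClosedUnderColimitsOfShape_shifts_singleton 0 (hQ J)
  | succ n ih =>
    exact isClosedUnderColimitsOfShape_extensionProduct ih
      (isClosedUnderColimitsOfShape_shifts_singleton _ (hQ J))

theorem boundedLevel_le (K : Type t → Prop) (Q : ObjectProperty C) {n : ℕ} {I : Set ℤ}
    (hI : ∀ i : ℤ, 0 ≤ i → i ≤ n → i ∈ I) : boundedLevel Q n ≤ closure K (shifts I Q) := by
  induction n with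
  | zero =>
    refine le_trans (shifts_mono ?_ le_rfl) (le_closure _ _)
    simpa using hI 0
  | succ n ih =>
    refine (isClosedClass_closure K (shifts I Q)).extensionProduct_le
      (ih fun i h1 h2 => hI i h1 (by push_cast; lia))
      (le_trans (shifts_mono ?_ le_rfl) (le_closure _ _))
    simpa using hI (n + 1) (by positivity) (by push_cast; lia)

theorem IsNegative.closure_Ici_zero_le [IsTriangulated C] [HasCoproducts.{t} C]
    (h : IsNegative K Q) [Q.IsClosedUnderIsomorphisms] (hQ : IsSmashingClass.{t} Q) (n : ℕ) :
    closure K (shifts (Set.Ici 0) Q) ≤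
      (boundedLevel Q n).extensionProduct (closure K (shifts (Set.Ici (n + 1 : ℤ)) Q)) := by
  induction n with
  | zero => simpa [boundedLevel] using h.closure_Ici_le hQ 0
  | succ n ih =>
    refine ih.trans ?_
    rw [boundedLevel, extensionProduct_assoc]
    exact extensionProduct_mono le_rfl (by exact_mod_cast h.closure_Ici_le hQ (n + 1))

/-- Countable coproducts of elements of the classes `boundedLevel Q n`. -/
def sigmaBoundedLevel [HasCoproductsOfShape ℕ C] (Q : ObjectProperty C) : ObjectProperty C :=
  fun X => ∃ F : ℕ → C, (∀ n, boundedLevel Q n (F n)) ∧ Nonempty (X ≅ ∐ F)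

instance [HasCoproductsOfShape ℕ C] : (sigmaBoundedLevel Q).IsClosedUnderIsomorphisms where
  of_iso e := fun ⟨F, hF, ⟨e'⟩⟩ => ⟨F, hF, ⟨e.symm ≪≫ e'⟩⟩

/-- Coproducts commute with coproducts. -/
noncomputable def sigmaSigmaComm {J J' : Type*} [HasCoproductsOfShape J C]
    [HasCoproductsOfShape J' C] (F : J → J' → C) :
    (∐ fun j => ∐ F j) ≅ ∐ fun j' => ∐ fun j => F j j' where
  hom := Sigma.desc fun j => Sigma.desc fun j' =>
    Sigma.ι (fun j => F j j') j ≫ Sigma.ι (fun j' => ∐ fun j => F j j') j'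
  inv := Sigma.desc fun j' => Sigma.desc fun j =>
    Sigma.ι (F j) j' ≫ Sigma.ι (fun j => ∐ F j) j
  hom_inv_id := Limits.Sigma.hom_ext _ _ fun j => Limits.Sigma.hom_ext _ _ fun j' => by simp
  inv_hom_id := Limits.Sigma.hom_ext _ _ fun j => Limits.Sigma.hom_ext _ _ fun j' => by simp

theorem isSmashingClass_sigmaBoundedLevel [HasCoproductsOfShape ℕ C] [HasCoproducts.{t} C]
    [Q.IsClosedUnderIsomorphisms] (hQ : IsSmashingClass.{t} Q) :
    IsSmashingClass.{t} (sigmaBoundedLevel Q) := fun J => by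
  refine isClosedUnderColimitsOfShape_discrete' fun M hM => ?_
  choose F hF e using hM
  refine ⟨fun n => ∐ fun j => F j n, fun n => ?_,
    ⟨Limits.Sigma.mapIso (fun j => (e j).some) ≪≫ sigmaSigmaComm F⟩⟩
  have := isSmashingClass_boundedLevel hQ n J
  exact prop_sigma _ _ fun j => hF j n

theorem exists_eq_shift_map {X Y : C} (n : ℤ) (f : X⟦n⟧ ⟶ Y⟦n⟧) : ∃ g : X ⟶ Y, f = g⟦n⟧' :=
  ⟨_, ((shiftFunctor C n).map_preimage f).symm⟩

/-- A morphism in the localizing subcategory generated by `Q` is an isomorphism if it induces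
bijections on the morphisms from the shifts of elements of `Q`. -/
theorem isIso_of_injective_of_surjective {N M : C} (φ : N ⟶ M)
    (hN : closure K (shifts Set.univ Q) N) (hM : closure K (shifts Set.univ Q) M)
    (inj : ∀ X, shifts Set.univ Q X → ∀ x : X ⟶ N, x ≫ φ = 0 → x = 0)
    (surj : ∀ X, shifts Set.univ Q X → ∀ y : X ⟶ M, ∃ x : X ⟶ N, y = x ≫ φ) : IsIso φ := by
  -- The cone lies in the subcategory generated by `Q` and receives no nonzero morphism from any
  -- shift of `Q`, so its identity vanishes.
  obtain ⟨Z, a, b, hT⟩ := distinguished_cocone_triangle φ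
  have hE := isClosedClass_closure K (shifts Set.univ Q)
  have hZ : closure K (shifts Set.univ Q) Z :=
    hE.ext _ (rot_of_distTriang _ hT) hM (closure_shifts_shift (by simp) hN)
  have h0 : Orthogonal (shifts Set.univ Q) (fun Y => Y = Z) := by
    rintro X Y hX rfl z
    have hX' : shifts Set.univ Q (X⟦(-1 : ℤ)⟧) := shifts_shift (by simp) hX
    let e := (shiftFunctorCompIsoId C (-1 : ℤ) 1 (by simp)).app X
    have hzb : z ≫ b = 0 := by
      obtain ⟨n, hn⟩ := exists_eq_shift_map 1 (e.hom ≫ z ≫ b)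
      have hn0 : n = 0 := inj _ hX' n (eq_zero_of_shift_map 1 _ (by
        rw [Functor.map_comp, ← hn, Category.assoc, Category.assoc,
          comp_zero₃₁_of_distTriang hT, comp_zero, comp_zero]))
      rw [← cancel_epi e.hom, hn, hn0, Functor.map_zero, comp_zero]
    obtain ⟨m, rfl⟩ := exists_lift₃ hT z hzb
    obtain ⟨x, rfl⟩ := surj X hX m
    rw [Category.assoc, comp_zero₁₂_of_distTriang hT, comp_zero]
  have hZ0 : IsZero Z := (IsZero.iff_id_eq_zero Z).2 (h0.closure_left hZ rfl (𝟙 Z))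
  exact (Triangle.isZero₃_iff_isIso₁ _ hT).1 hZ0

/-- Every element of `[⋃_{i ≥ 0} Q[i]]` is the homotopy colimit of its bounded pieces. -/
theorem IsNegative.closure_Ici_zero_le_telescope [IsTriangulated C] [HasCoproducts.{t} C]
    [HasCoproductsOfShape ℕ C] (h : IsNegative K Q) [Q.IsClosedUnderIsomorphisms]
    (hQ : IsSmashingClass.{t} Q) (hK : K (ULift.{t} ℕ)) :
    closure K (shifts (Set.Ici 0) Q) ≤
      (sigmaBoundedLevel Q).extensionProduct (shifts {1} (sigmaBoundedLevel Q)) := by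
  intro M hM
  choose F B f g k hT hF hB using fun n => h.closure_Ici_zero_le hQ n M hM
  -- `F n` has weights at most `n` and `B (n + 1)` at least `n + 2`, so `f n` lifts to `F (n + 1)`.
  have hlift : ∀ n, ∃ τ : F n ⟶ F (n + 1), f n = τ ≫ f (n + 1) := fun n =>
    exists_lift₂ (hT (n + 1)) (f n) (h.orthogonal (m := n) (by push_cast; lia)
      (boundedLevel_le K Q (fun i _ hi => hi) _ (hF n)) (hB (n + 1)) _)
  choose τ hτ using hlift
  have hnat : ∀ I : Set ℤ,
      (closure K (shifts I Q)).IsClosedUnderColimitsOfShape (Discrete ℕ) := fun I =>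
    isClosedUnderColimitsOfShape_of_equiv Equiv.ulift ((isClosedClass_closure K _).coprod _ hK)
  -- For `X = Y[i]`, dropping the first `max (i + 1) 0` terms leaves all `B` in weights at least `i
  -- + 2`. Then neither `X` nor `X[1]` maps nontrivially to their countable coproduct, which gives
  -- surjectivity and injectivity on the tail.
  have exact : ∀ X, shifts Set.univ Q X → _ := fun X hX =>
    telescope_exact (X := X) (fun n => (hτ n).symm)
      (hX.choose + 1).toNat (by
        obtain ⟨Y, hY, e⟩ := hX.choose_spec.2
        set i := hX.choose
        obtain ⟨p, q, hpq⟩ := exists_sigma_triangle (fun n => f (n + (i + 1).toNat)) _ _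
          (fun n => hT (n + (i + 1).toNat))
        intro y
        refine exists_lift₂ hpq y (h.orthogonal (m := i) (n := i + 1) (by lia)
          (le_closure _ _ _ ⟨i, Set.mem_Iic.2 le_rfl, Y, hY, e⟩) ?_ _)
        have := hnat (Set.Ici (i + 1))
        refine prop_sigma _ _ fun n => closure_mono (fun _ => id) (shifts_mono ?_ le_rfl) _ (hB _)
        intro j hj
        simp only [Set.mem_Ici] at *
        lia) (by
        obtain ⟨Y, hY, e⟩ := hX.choose_spec.2
        set i := hX.choose
        obtain ⟨p, q, hpq⟩ := exists_sigma_triangle (fun n => f (n + (i + 1).toNat)) _ _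
          (fun n => hT (n + (i + 1).toNat))
        intro z hz
        obtain ⟨b, hb⟩ := exists_lift₁ hpq (z⟦(1 : ℤ)⟧') (by
          rw [← Functor.map_comp, hz, Functor.map_zero])
        have hb0 : b = 0 := by
          refine h.orthogonal (m := i + 1) (n := i + 2) (by lia) (closure_shifts_shift (I := {i})
            (by simp) (le_closure _ _ _ ⟨i, rfl, Y, hY, e⟩)) ?_ _
          have := hnat (Set.Ici (i + 2))
          refine prop_sigma _ _ fun n =>
            closure_mono (fun _ => id) (shifts_mono ?_ le_rfl) _ (hB _)
          intro j hj
          simp only [Set.mem_Ici] at *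
          lia
        exact eq_zero_of_shift_map 1 z (by rw [hb, hb0, zero_comp]))
  obtain ⟨N, q, d, hN⟩ := distinguished_cocone_triangle (𝟙 (∐ F) - telescopeShift τ)
  obtain ⟨φ, hφ⟩ := exists_desc₂ hN (Sigma.desc f) (by
    refine Limits.Sigma.hom_ext _ _ fun n => ?_
    rw [Preadditive.sub_comp, Preadditive.comp_sub, reassoc_of% ι_telescopeShift]
    simp [← hτ])
  have hN' := rot_of_distTriang _ hN
  have hFσ : sigmaBoundedLevel Q (∐ F) := ⟨F, hF, ⟨Iso.refl _⟩⟩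
  have hFE : closure K (shifts Set.univ Q) (∐ F) := by
    have := hnat Set.univ
    exact prop_sigma _ _ fun n => boundedLevel_le K Q (by simp) _ (hF n)
  have hE := isClosedClass_closure K (shifts Set.univ Q)
  have hNE : closure K (shifts Set.univ Q) N :=
    hE.ext _ hN' hFE (closure_shifts_shift (by simp) hFE)
  -- The exactness statements for `X` and `X[-1]` identify the morphisms from `X` to the telescope
  -- `N` with those to `M`.
  have : IsIso φ := by
    refine isIso_of_injective_of_surjective φ hNE
      (closure_mono (fun _ => id) (shifts_mono (Set.subset_univ _) le_rfl) _ hM) ?_ ?_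
    · intro X hX x hx
      have hX' : shifts Set.univ Q (X⟦(-1 : ℤ)⟧) := shifts_shift (by simp) hX
      let e := (shiftFunctorCompIsoId C (-1 : ℤ) 1 (by simp)).app X
      have hxd : x ≫ d = 0 := by
        obtain ⟨y, hy⟩ := exists_eq_shift_map 1 (e.hom ≫ x ≫ d)
        have hy0 : y = 0 := (exact _ hX').2.2 y (eq_zero_of_shift_map 1 _ (by
          rw [Functor.map_comp, ← hy, Category.assoc, Category.assoc,
            comp_zero₃₁_of_distTriang hN, comp_zero, comp_zero]))
        rw [← cancel_epi e.hom, hy, hy0, Functor.map_zero, comp_zero]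
      obtain ⟨y, rfl⟩ := exists_lift₃ hN x hxd
      obtain ⟨z, rfl⟩ := (exact X hX).2.1 y (by rw [hφ, ← Category.assoc, hx])
      rw [Category.assoc, comp_zero₁₂_of_distTriang hN, comp_zero]
    · intro X hX y
      obtain ⟨x, hx⟩ := (exact X hX).1 y
      exact ⟨x ≫ q, by rw [hx, hφ, Category.assoc]⟩
  -- The rotated telescope triangle presents `N` as an extension of `(∐ F)[1]` by `∐ F`.
  exact prop_of_iso _ (asIso φ) ⟨_, _, _, _, _, hN', hFσ, shifts_singleton_obj 1 hFσ⟩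

/-- Each `M j` is an extension of two objects from `sigmaBoundedLevel Q` and its shift. Those
classes have all small coproducts and lie in the closure, as only countable coproducts enter in
building them. -/
theorem IsNegative.isSmashingClass_closure [IsTriangulated C] [HasCoproducts.{t} C]
    (h : IsNegative K Q) [Q.IsClosedUnderIsomorphisms] (hQ : IsSmashingClass.{t} Q)
    (hK : K (ULift.{t} ℕ)) : IsSmashingClass.{t} (closure K (shifts (Set.Ici 0) Q)) := fun J => by
  have := hasCoproductsOfShape_nat.{t} (C := C)
  refine isClosedUnderColimitsOfShape_discrete' fun M hM => ?_
  have hσ : sigmaBoundedLevel Q ≤ closure K (shifts (Set.Ici 0) Q) := by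
    rintro X ⟨F, hF, ⟨e⟩⟩
    have : (closure K (shifts (Set.Ici 0) Q)).IsClosedUnderColimitsOfShape (Discrete ℕ) :=
      isClosedUnderColimitsOfShape_of_equiv Equiv.ulift ((isClosedClass_closure K _).coprod _ hK)
    exact prop_of_iso _ e.symm
      (prop_sigma _ _ fun n => boundedLevel_le K Q (by simp +contextual) _ (hF n))
  have hclosed : ((sigmaBoundedLevel Q).extensionProduct
      (shifts {1} (sigmaBoundedLevel Q))).IsClosedUnderColimitsOfShape (Discrete J) :=
    isClosedUnderColimitsOfShape_extensionProduct (isSmashingClass_sigmaBoundedLevel hQ J)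
      (isClosedUnderColimitsOfShape_shifts_singleton 1 (isSmashingClass_sigmaBoundedLevel hQ J))
  refine (isClosedClass_closure K _).extensionProduct_le hσ ?_ _
    (prop_sigma _ M fun j => h.closure_Ici_zero_le_telescope hQ hK _ (hM j))
  rintro X ⟨_, rfl, Y, hY, ⟨e⟩⟩
  refine prop_of_iso _ e.symm (closure_shifts_shift ?_ (hσ _ hY))
  intro i hi
  simp only [Set.mem_Ici] at *
  lia

/-- `P` is class-negative if and only if the class of coproducts of its elements is countably
negative. -/
theorem classNegative_iff_countablyNegative [IsTriangulated C] [HasCoproducts.{t} C]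
    (P : ObjectProperty C) :
    ClassNegative.{t} P ↔ CountablyNegative.{t} (coproductsOf.{t} P) := by
  rw [classNegative_iff, CountablyNegative, cardNegative_iff]
  constructor
  · intro h X Y hX hY f
    refine coproductsOf_le (fun J => (isClosedClass_leftOrthogonal (fun _ : Type t => True)
      (closure (fun _ : Type t => True) (shifts (Set.Ioi 0) P))).coprod J trivial)
      (fun X hX Y f hY => h hX hY f) X hX f ?_
    -- Coproducts of elements of `P` already lie in smashing closures of `P`, so enlarging the
    -- generators on the right changes nothing.
    refine closure_le (K := fun _ => True) (isClosedClass_closure _ _) ?_ Y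
      (closure_mono (fun _ _ => trivial) le_rfl _ hY)
    rintro Z ⟨i, hi, Z', hZ', ⟨e⟩⟩
    refine prop_of_iso _ e.symm ?_
    refine coproductsOf_le (Q := (closure (fun _ : Type t => True)
      (shifts (Set.Ioi 0) P)).shift i) (fun J => ((isClosedClass_closure _ _).shift i).coprod J
        trivial) ?_ _ hZ'
    exact fun W hW => le_closure _ _ _ (shifts_obj hi hW)
  · intro h X Y hX hY f
    -- The `ℵ₁`-closure is in fact closed under all coproducts, so it absorbs the full smashing
    -- closure of the shifts of `P`.
    have hs := h.isSmashingClass_closure (isSmashingClass_coproductsOf P) (by simp)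
    have hc := isClosedClass_closure (fun J : Type t => Cardinal.mk J < Cardinal.aleph 1)
      (shifts (Set.Ici 0) (coproductsOf.{t} P))
    refine h.orthogonal (m := 0) (n := 1) (by lia)
      (le_closure _ _ _ (le_shifts (by simp) _ _ (le_coproductsOf P _ hX))) (Y := Y) ?_ f
    have h1 : IsClosedClass (fun _ : Type t => True)
        ((closure (fun J : Type t => Cardinal.mk J < Cardinal.aleph 1)
          (shifts (Set.Ici 0) (coproductsOf.{t} P))).shift (-1 : ℤ)) :=
      IsClosedClass.shift ⟨hc.1, fun J _ => hs J⟩ (-1)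
    have h2 := closure_le h1 (P := shifts (Set.Ioi 0) P) (fun Z hZ => le_closure _ _ _
      (shifts_shift (I' := Set.Ici 0) (n := -1) (by
        intro i hi
        simp only [Set.mem_Ici, Set.mem_Ioi] at *
        lia) (shifts_mono le_rfl (le_coproductsOf P) _ hZ))) Y hY
    refine prop_of_iso _ ((shiftFunctorCompIsoId C (-1 : ℤ) 1 (by simp)).app Y)
      (closure_shifts_shift ?_ h2)
    intro i hi
    simp only [Set.mem_Ici] at *
    lia

end

end WeightTheory

namespace WeightTheory

variable {C : Type u} [Category.{v} C] [HasZeroObject C] [HasShift C ℤ] [Preadditive C]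
  [∀ n : ℤ, (shiftFunctor C n).Additive] [Pretriangulated C]

open ObjectProperty

/-! ### Retract-closedness of the two halves. -/

section Retracts

variable {K : Type t → Prop} {P : ObjectProperty C}

theorem IsClosedClass.isClosedUnderColimitsOfShape_nat {Q : ObjectProperty C}
    (hQ : IsClosedClass K Q) (hK : K (ULift.{t} ℕ)) :
    Q.IsClosedUnderColimitsOfShape (Discrete ℕ) :=
  isClosedUnderColimitsOfShape_of_equiv Equiv.ulift (hQ.coprod _ hK)

theorem closure_Ici_shift {X : C} {n : ℤ} (hn : 0 ≤ n)
    (hX : closure K (shifts (Set.Ici 0) P) X) : closure K (shifts (Set.Ici 0) P) (X⟦n⟧) :=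
  closure_shifts_shift (fun i hi => by simp only [Set.mem_Ici] at *; lia) hX

theorem closure_Iic_shift {X : C} {n : ℤ} (hn : n ≤ 0)
    (hX : closure K (shifts (Set.Iic 0) P) X) : closure K (shifts (Set.Iic 0) P) (X⟦n⟧) :=
  closure_shifts_shift (fun i hi => by simp only [Set.mem_Iic] at *; lia) hX

theorem closure_Ici_of_retract [HasCoproductsOfShape ℕ C] (hK : K (ULift.{t} ℕ)) {X M : C}
    (r : Retract X M) (hM : closure K (shifts (Set.Ici 0) P) M) :
    closure K (shifts (Set.Ici 0) P) X :=
  have h := isClosedClass_closure K (shifts (Set.Ici 0) P)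
  h.of_retract_of_nat (h.isClosedUnderColimitsOfShape_nat hK) (Or.inl rfl)
    (fun _ hY => closure_Ici_shift zero_le_one hY) r hM

theorem closure_Iic_of_retract [HasCoproductsOfShape ℕ C] (hK : K (ULift.{t} ℕ)) {X M : C}
    (r : Retract X M) (hM : closure K (shifts (Set.Iic 0) P) M) :
    closure K (shifts (Set.Iic 0) P) X :=
  have h := isClosedClass_closure K (shifts (Set.Iic 0) P)
  h.of_retract_of_nat (h.isClosedUnderColimitsOfShape_nat hK) (Or.inr rfl)
    (fun _ hY => closure_Iic_shift (by simp) hY) r hM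

/-- If `R` is stable under the shift by `ε`, the objects that are moved into `R` by an iterated
shift by `ε` form a class stable under extensions and finite coproducts. -/
theorem IsClosedClass.exists_shift_nat {R : ObjectProperty C} (hR : IsClosedClass K R)
    (hK : ∀ J, K J → Finite J) {ε : ℤ} (hRε : ∀ Y, R Y → R (Y⟦ε⟧)) :
    IsClosedClass K fun X => ∃ n : ℕ, R (X⟦(n : ℤ) * ε⟧) := by
  have := hR.isClosedUnderIsomorphisms
  have mono : ∀ (X : C) (m n : ℕ), m ≤ n → R (X⟦(m : ℤ) * ε⟧) → R (X⟦(n : ℤ) * ε⟧) := by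
    intro X m n hmn hX
    induction n, hmn using Nat.le_induction with
    | base => exact hX
    | succ n _ ih =>
      exact R.prop_of_iso ((shiftFunctorAdd' C (n * ε) ε _ (by push_cast; ring)).app X).symm
        (hRε _ ih)
  refine ⟨⟨fun X hX => ⟨0, hR.zero _ (Functor.map_isZero _ hX)⟩, ?_⟩, fun J hJ => ?_⟩
  · rintro T hT ⟨m, hm⟩ ⟨n, hn⟩
    exact ⟨max m n, (hR.shift _).ext T hT (mono _ _ _ (le_max_left _ _) hm)
      (mono _ _ _ (le_max_right _ _) hn)⟩
  · have := hK J hJ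
    refine isClosedUnderColimitsOfShape_discrete fun f c hc hf => ?_
    choose n hn using hf
    -- Finiteness of `J` gives one shift that works for every member of the family.
    obtain ⟨N, hN⟩ := (Set.finite_range n).bddAbove
    have := (hR.shift (N * ε)).coprod J hJ
    exact ⟨N, prop_of_isColimit_cofan (R.shift (N * ε : ℤ)) hc
      fun j => mono _ _ _ (hN ⟨j, rfl⟩) (hn j)⟩

/-- With finite coproducts only, the swindle is unavailable. Instead every object of the generated
subcategory enters the class after enough shifts, and one descends a shift at a time. -/
theorem closure_Ici_of_retract_of_finite (hK : ∀ J, K J → Finite J) {X M : C}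
    (hX : closure K (shifts Set.univ P) X) (r : Retract X M)
    (hM : closure K (shifts (Set.Ici 0) P) M) : closure K (shifts (Set.Ici 0) P) X := by
  have h := isClosedClass_closure K (shifts (Set.Ici 0) P)
  have h1 : ∀ Y, closure K (shifts (Set.Ici 0) P) Y →
    closure K (shifts (Set.Ici 0) P) (Y⟦(1 : ℤ)⟧) := fun Y hY => closure_Ici_shift zero_le_one hY
  obtain ⟨n, hn⟩ := closure_le (h.exists_shift_nat hK h1) (by
    rintro Y ⟨i, -, Z, hZ, e⟩
    refine ⟨(-i).toNat, le_closure _ _ _ (shifts_shift (I := {i}) ?_ ⟨i, rfl, Z, hZ, e⟩)⟩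
    simp only [Set.mem_singleton_iff, Set.mem_Ici, forall_eq]
    lia) X hX
  exact h.of_retract_of_shift_nat (Or.inl rfl) h1 n r hM hn

theorem closure_Iic_of_retract_of_finite (hK : ∀ J, K J → Finite J) {X M : C}
    (hX : closure K (shifts Set.univ P) X) (r : Retract X M)
    (hM : closure K (shifts (Set.Iic 0) P) M) : closure K (shifts (Set.Iic 0) P) X := by
  have h := isClosedClass_closure K (shifts (Set.Iic 0) P)
  have h1 : ∀ Y, closure K (shifts (Set.Iic 0) P) Y →
    closure K (shifts (Set.Iic 0) P) (Y⟦(-1 : ℤ)⟧) := fun Y hY => closure_Iic_shift (by simp) hY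
  obtain ⟨n, hn⟩ := closure_le (h.exists_shift_nat hK h1) (by
    rintro Y ⟨i, -, Z, hZ, e⟩
    refine ⟨i.toNat, le_closure _ _ _ (shifts_shift (I := {i}) ?_ ⟨i, rfl, Z, hZ, e⟩)⟩
    simp only [Set.mem_singleton_iff, Set.mem_Iic, forall_eq]
    lia) X hX
  exact h.of_retract_of_shift_nat (Or.inr rfl) h1 n r hM hn

/-- In a distinguished triangle whose second morphism vanishes, the second object is a retract of
the first one. -/
theorem nonempty_retract_of_distTriang_left {X Y Z : C} {f : X ⟶ Y} {g : Y ⟶ Z}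
    {h : Z ⟶ X⟦(1 : ℤ)⟧} (hT : Triangle.mk f g h ∈ distTriang C) (hg : g = 0) :
    Nonempty (Retract Y X) := by
  obtain ⟨s, hs⟩ := exists_lift₂ hT (𝟙 Y) (by rw [hg, comp_zero])
  exact ⟨⟨s, f, hs.symm⟩⟩

theorem nonempty_retract_of_distTriang_right {X Y Z : C} {f : X ⟶ Y} {g : Y ⟶ Z}
    {h : Z ⟶ X⟦(1 : ℤ)⟧} (hT : Triangle.mk f g h ∈ distTriang C) (hf : f = 0) :
    Nonempty (Retract Y Z) := by
  obtain ⟨s, hs⟩ := exists_desc₂ hT (𝟙 Y) (by rw [hf, zero_comp])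
  exact ⟨⟨g, s, hs.symm⟩⟩

end Retracts

/-! ### General weight structures and class-generated ones. -/

namespace WeightStructure

variable (w : WeightStructure C)

instance : w.le.IsStableUnderRetracts := w.le_retract
instance : w.ge.IsStableUnderRetracts := w.ge_retract

/-- If `X` is orthogonal to the upper half, the second map of its weight decomposition vanishes,
making `X` a retract of the lower term. -/
theorem le_iff (X : C) : w.le X ↔ ∀ Y, w.ge Y → ∀ f : X ⟶ Y⟦(1 : ℤ)⟧, f = 0 := by
  refine ⟨fun hX Y hY f => w.orthogonal hX hY f, fun h => ?_⟩
  obtain ⟨A, B, f, g, k, hA, hB, hT⟩ := w.decomposition X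
  obtain ⟨r⟩ := nonempty_retract_of_distTriang_left hT (h B hB g)
  exact prop_of_retract _ r hA

theorem ge_iff (Y : C) : w.ge Y ↔ ∀ X, w.le X → ∀ f : X ⟶ Y⟦(1 : ℤ)⟧, f = 0 := by
  refine ⟨fun hY X hX f => w.orthogonal hX hY f, fun h => ?_⟩
  obtain ⟨A, B, f, g, k, hA, hB, hT⟩ := w.decomposition (Y⟦(1 : ℤ)⟧)
  obtain ⟨r⟩ := nonempty_retract_of_distTriang_right hT (h A hA f)
  let e (X : C) := (shiftFunctorCompIsoId C (1 : ℤ) (-1) (by simp)).app X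
  exact prop_of_retract _ ((Retract.ofIso (e Y).symm).trans
    ((r.map (shiftFunctor C (-1 : ℤ))).trans (Retract.ofIso (e B)))) hB

/-- The lower half is a left orthogonal, hence closed under all existing coproducts without any
smashing hypothesis. -/
theorem isClosedClass_le (K : Type t → Prop) : IsClosedClass K w.le := by
  have : w.le = (shifts {1} w.ge).leftOrthogonal := by
    ext X
    rw [w.le_iff]
    constructor
    · rintro h Y f ⟨_, rfl, Y', hY', ⟨e⟩⟩
      rw [← cancel_mono e.hom, h _ hY' (f ≫ e.hom), zero_comp]
    · exact fun h Y hY f => h f (shifts_singleton_obj 1 hY)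
  rw [this]
  exact isClosedClass_leftOrthogonal K _

theorem isExtensionClosed_ge : IsExtensionClosed w.ge := by
  -- Allowing no index types turns `IsClosedClass` into extension-closedness alone, so that its
  -- shift lemma can be reused.
  have h : IsClosedClass (fun _ : Type => False) w.le.rightOrthogonal :=
    ⟨isExtensionClosed_rightOrthogonal _, fun _ h => h.elim⟩
  have : w.ge = w.le.rightOrthogonal.shift (1 : ℤ) := by
    ext Y
    rw [w.ge_iff]
    exact ⟨fun h X f hX => h X hX f, fun h X hX f => h f hX⟩
  rw [this]
  exact (h.shift 1).1

theorem le_shift_of_nonpos {X : C} (hX : w.le X) {n : ℤ} (hn : n ≤ 0) : w.le (X⟦n⟧) := by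
  obtain ⟨m, rfl⟩ : ∃ m : ℕ, n = -m := ⟨(-n).toNat, by lia⟩
  clear hn
  induction m with
  | zero => exact w.le.prop_of_iso ((shiftFunctorZero' C _ (by simp)).app X).symm hX
  | succ m ih =>
    exact w.le.prop_of_iso ((shiftFunctorAdd' C (-m : ℤ) (-1) _ (by push_cast; ring)).app X).symm
      (w.le_shift _ ih)

theorem ge_shift_of_nonneg {X : C} (hX : w.ge X) {n : ℤ} (hn : 0 ≤ n) : w.ge (X⟦n⟧) := by
  obtain ⟨m, rfl⟩ := Int.eq_ofNat_of_zero_le hn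
  clear hn
  induction m with
  | zero => exact w.ge.prop_of_iso ((shiftFunctorZero' C _ (by simp)).app X).symm hX
  | succ m ih =>
    exact w.ge.prop_of_iso ((shiftFunctorAdd' C (m : ℤ) 1 _ (by push_cast; ring)).app X).symm
      (w.ge_shift _ ih)

theorem leInt_iff (n : ℤ) (X : C) : w.leInt n X ↔ w.le (X⟦-n⟧) := by
  rw [leInt, shifts_singleton_eq]; rfl

theorem geInt_iff (n : ℤ) (X : C) : w.geInt n X ↔ w.ge (X⟦-n⟧) := by
  rw [geInt, shifts_singleton_eq]; rfl

theorem geInt_mono {m n : ℤ} (hmn : m ≤ n) : w.geInt n ≤ w.geInt m := fun X hX => by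
  rw [geInt_iff] at *
  exact w.ge.prop_of_iso ((shiftFunctorAdd' C (-n) (n - m) (-m) (by lia)).app X).symm
    (w.ge_shift_of_nonneg hX (by lia))

theorem leInt_zero : w.leInt 0 = w.le := by
  rw [leInt, shifts_singleton_eq, neg_zero, shift_zero]

theorem geInt_zero : w.geInt 0 = w.ge := by
  rw [geInt, shifts_singleton_eq, neg_zero, shift_zero]

theorem isClosedClass_leInt (K : Type t → Prop) (n : ℤ) : IsClosedClass K (w.leInt n) := by
  rw [leInt, shifts_singleton_eq]
  exact (w.isClosedClass_le K).shift _

theorem isExtensionClosed_geInt (n : ℤ) : IsExtensionClosed (w.geInt n) := by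
  have h : IsClosedClass (fun _ : Type => False) w.ge := ⟨w.isExtensionClosed_ge, fun _ h => h.elim⟩
  rw [geInt, shifts_singleton_eq]
  exact (h.shift _).1

theorem leInt_shift {n : ℤ} {X : C} (hX : w.leInt n X) {m k : ℤ} (h : n + m = k) :
    w.leInt k (X⟦m⟧) := by
  rw [leInt_iff] at *
  exact w.le.prop_of_iso ((shiftFunctorAdd' C m (-k) (-n) (by lia)).app X) hX

theorem geInt_shift {n : ℤ} {X : C} (hX : w.geInt n X) {m k : ℤ} (h : n + m = k) :
    w.geInt k (X⟦m⟧) := by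
  rw [geInt_iff] at *
  exact w.ge.prop_of_iso ((shiftFunctorAdd' C m (-k) (-n) (by lia)).app X) hX

theorem orthogonal_int {m n : ℤ} (hmn : m < n) : Orthogonal (w.leInt m) (w.geInt n) := by
  rintro X Y ⟨i, hi, X', hX', ⟨e⟩⟩ hY f
  rw [Set.mem_singleton_iff.1 hi] at e
  rw [← cancel_epi e.inv, comp_zero]
  refine eq_zero_of_shift_left (fun g => ?_) _
  obtain ⟨_, rfl, Z, hZ, ⟨e'⟩⟩ :=
    w.geInt_mono (m := 1) (n := n - m) (by lia) _ (w.geInt_shift hY (m := -m) (by lia))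
  rw [← cancel_mono e'.hom, zero_comp]
  exact w.orthogonal hX' hZ _

theorem decomposition_int (n : ℤ) :
    (w.leInt n).extensionProduct (w.geInt (n + 1)) = (⊤ : ObjectProperty C) := by
  ext M
  refine ⟨fun _ => trivial, fun _ => ?_⟩
  obtain ⟨A, B, f, g, h, hA, hB, hT⟩ := w.decomposition (M⟦-n⟧)
  refine prop_of_iso _ ((shiftFunctorCompIsoId C (-n) n (by simp)).app M)
    ⟨_, _, _, _, _, Triangle.shift_distinguished _ hT n, shifts_singleton_obj n hA, ?_⟩
  exact w.geInt_shift (w.geInt_shift (n := 0) (by rwa [geInt_zero]) (m := 1) rfl) (by lia)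

/-- Enlarging one half shrinks its orthogonal, which is the other half; both cannot grow properly.
-/
theorem eq_of_le {w w' : WeightStructure C} (hle : w.le ≤ w'.le) (hge : w.ge ≤ w'.ge) :
    w' = w := by
  refine WeightStructure.ext (le_antisymm ?_ hle) (le_antisymm ?_ hge)
  · exact fun X hX => (w.le_iff X).2 fun Y hY => w'.orthogonal hX (hge _ hY)
  · exact fun Y hY => (w.ge_iff Y).2 fun X hX => w'.orthogonal (hle _ hX) hY

variable {w} {P : ObjectProperty C}

theorem closure_shifts_le_le (K : Type t → Prop) (hP : P ≤ w.le) :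
    closure K (shifts (Set.Iic 0) P) ≤ w.le := by
  refine closure_le (w.isClosedClass_le K) ?_
  rintro X ⟨i, hi, Y, hY, ⟨e⟩⟩
  exact w.le.prop_of_iso e.symm (w.le_shift_of_nonpos (hP _ hY) hi)

theorem closure_shifts_le_ge {K : Type t → Prop} (hK : IsClosedClass K w.ge) (hP : P ≤ w.ge) :
    closure K (shifts (Set.Ici 0) P) ≤ w.ge := by
  refine closure_le hK ?_
  rintro X ⟨i, hi, Y, hY, ⟨e⟩⟩
  exact w.ge.prop_of_iso e.symm (w.ge_shift_of_nonneg (hP _ hY) hi)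

theorem IsSmashing.isClosedClass (hw : w.IsSmashing.{t}) (K : Type t → Prop) :
    IsClosedClass K w.ge :=
  ⟨w.isExtensionClosed_ge, fun J _ => hw.2 J⟩

theorem isNegative_of_le_heart {K : Type t → Prop} (hK : IsClosedClass K w.ge)
    (hP : P ≤ w.heart) : IsNegative K P := by
  intro X Y hX hY f
  refine w.orthogonal_int (m := 0) (n := 1) (by lia) ?_ ?_ f
  · rw [leInt_zero]
    exact (hP _ hX).1
  · rw [geInt_iff]
    refine closure_shifts_le_ge hK (fun X hX => (hP X hX).2) _ (closure_shifts_shift ?_ hY)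
    intro i hi
    simp only [Set.mem_Ici, Set.mem_Ioi] at *
    lia

theorem isClassGeneratedBy_iff : w.IsClassGeneratedBy.{t} P ↔ HasCoproducts.{t} C ∧
    w.ge = closure (fun _ : Type t => True) (shifts (Set.Ici 0) P) ∧
    w.le = closure (fun _ : Type t => True) (shifts (Set.Iic 0) P) := by
  rw [IsClassGeneratedBy, smashingClosure_eq, smashingClosure_eq]

theorem IsClassGeneratedBy.le_heart (hw : w.IsClassGeneratedBy.{t} P) : P ≤ w.heart := by
  obtain ⟨-, hge, hle⟩ := isClassGeneratedBy_iff.1 hw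
  intro X hX
  refine ⟨?_, ?_⟩
  · rw [hle]
    exact le_closure _ _ _ (le_shifts (by simp) _ _ hX)
  · rw [hge]
    exact le_closure _ _ _ (le_shifts (by simp) _ _ hX)

theorem IsClassGeneratedBy.isSmashing (hw : w.IsClassGeneratedBy.{t} P) : w.IsSmashing.{t} := by
  obtain ⟨hC, hge, -⟩ := isClassGeneratedBy_iff.1 hw
  refine ⟨hC, fun J => ?_⟩
  rw [hge]
  exact (isClosedClass_closure _ _).coprod J trivial

theorem IsClassGeneratedBy.isNegative (hw : w.IsClassGeneratedBy.{t} P) (K : Type t → Prop) :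
    IsNegative K P :=
  isNegative_of_le_heart (hw.isSmashing.isClosedClass K) hw.le_heart

theorem localizing_eq (P : ObjectProperty C) :
    localizing.{t} P = closure (fun _ : Type t => True) (shifts Set.univ P) :=
  smashingClosure_eq _

theorem IsClassGeneratedBy.localizing_eq_top (hw : w.IsClassGeneratedBy.{t} P) :
    localizing.{t} P = ⊤ := by
  obtain ⟨-, hge, hle⟩ := isClassGeneratedBy_iff.1 hw
  rw [localizing_eq, eq_top_iff]
  intro M _
  obtain ⟨A, B, f, g, h, hA, hB, hT⟩ := w.decomposition M
  rw [hle] at hA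
  rw [hge] at hB
  exact (isClosedClass_closure _ _).mem hT
    (closure_mono (fun _ => id) (shifts_mono (Set.subset_univ _) le_rfl) _ hA)
    (closure_shifts_shift (by simp) hB)

/-- Such an object receives only zero morphisms from shifts of `P`, hence from the whole category
they generate, including itself. -/
theorem IsClassGeneratedBy.isLeftNondegenerate (hw : w.IsClassGeneratedBy.{t} P) :
    w.IsLeftNondegenerate := by
  intro X hX
  have h : Orthogonal (shifts Set.univ P) (fun Y => Y = X) := by
    rintro Y _ ⟨i, -, Z, hZ, e⟩ rfl f
    exact w.orthogonal_int (lt_add_one i) ⟨i, rfl, Z, (hw.le_heart _ hZ).1, e⟩ (hX _) f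
  refine (IsZero.iff_id_eq_zero X).2 ((h.closure_left (K := fun _ : Type t => True)) ?_ rfl _)
  rw [← localizing_eq, hw.localizing_eq_top]
  trivial

theorem IsClassGeneratedBy.isGeneratedBy (hw : w.IsClassGeneratedBy.{t} P) :
    w.IsGeneratedBy P := by
  obtain ⟨-, -, hle⟩ := isClassGeneratedBy_iff.1 hw
  ext Y
  constructor
  · rintro hY X f ⟨i, hi, X', hX', e⟩
    exact w.orthogonal_int (n := 0) hi ⟨i, rfl, X', (hw.le_heart _ hX').1, e⟩
      (by rwa [geInt_zero]) f
  · intro hY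
    rw [w.ge_iff]
    intro X hX f
    rw [hle] at hX
    have h : Orthogonal (shifts (Set.Iic 0) P) (fun Z => Z = Y⟦(1 : ℤ)⟧) := by
      rintro Z _ hZ rfl g
      refine eq_zero_of_shift_right (fun g => hY g (shifts_shift ?_ hZ)) g
      intro i hi
      simp only [Set.mem_Iic, Set.mem_Iio] at *
      lia
    exact h.closure_left hX rfl f

theorem IsSmashing.coproductsOf_le_heart (hw : w.IsSmashing.{t}) (hP : P ≤ w.heart) :
    coproductsOf.{t} P ≤ w.heart := by
  have h1 := coproductsOf_le (P := P) (Q := w.le)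
    (fun J => (w.isClosedClass_le (fun _ : Type t => True)).coprod J trivial)
    fun X hX => (hP X hX).1
  exact fun X hX => ⟨h1 X hX, coproductsOf_le hw.2 (fun X hX => (hP X hX).2) X hX⟩

/-- Splitting off weight `0` from `X` gives a triangle `A → X → B` with `A` a coproduct of elements
of `P` and `B` of weight at least `1`. For `X` in the heart the map to `B` is zero, so `X` is a
retract of `A`. -/
theorem IsClassGeneratedBy.heart_eq [IsTriangulated C] (hw : w.IsClassGeneratedBy.{t} P) :
    w.heart = (coproductsOf.{t} P).retractClosure := by
  have hC := hw.1
  have hQ := hw.isSmashing.coproductsOf_le_heart hw.le_heart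
  apply le_antisymm
  · rintro X ⟨hle, hge⟩
    rw [(isClassGeneratedBy_iff.1 hw).2.1] at hge
    have hcl := hw.isSmashing.isClosedClass (fun _ : Type t => True)
    obtain ⟨A, B, f, g, h, hT, hA, hB⟩ :=
      (isNegative_of_le_heart hcl hQ).closure_Ici_le (isSmashingClass_coproductsOf P) 0 X
        (closure_mono (fun _ => id) (shifts_mono le_rfl (le_coproductsOf P)) X hge)
    obtain ⟨r⟩ := nonempty_retract_of_distTriang_left hT (by
      refine w.orthogonal_int (m := 0) (n := 1) (by lia) (by rwa [leInt_zero]) ?_ g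
      rw [geInt_iff]
      refine closure_shifts_le_ge hcl (fun X hX => (hQ X hX).2) _ (closure_shifts_shift ?_ hB)
      intro i hi
      simp only [Set.mem_Ici] at *
      lia)
    rw [shifts_singleton_eq, neg_zero, shift_zero] at hA
    exact ⟨A, hA, ⟨r⟩⟩
  · rintro X ⟨Y, hY, ⟨r⟩⟩
    exact ⟨prop_of_retract _ r (hQ _ hY).1, prop_of_retract _ r (hQ _ hY).2⟩

theorem IsClassGeneratedBy.eq_of_isSmashing (hw : w.IsClassGeneratedBy.{t} P)
    {w' : WeightStructure C} (hw' : w'.IsSmashing.{t}) (hP : P ≤ w'.heart) : w' = w := by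
  obtain ⟨-, hge, hle⟩ := isClassGeneratedBy_iff.1 hw
  apply eq_of_le
  · rw [hle]
    exact closure_shifts_le_le _ fun X hX => (hP X hX).1
  · rw [hge]
    exact closure_shifts_le_ge (hw'.isClosedClass _) fun X hX => (hP X hX).2

/-- A class-negative class that generates `C` as a localizing subcategory class-generates a weight
structure. -/
theorem exists_isClassGeneratedBy [IsTriangulated C] [HasCoproducts.{t} C]
    (hP : ClassNegative.{t} P) (htop : localizing.{t} P = ⊤) :
    ∃ w : WeightStructure C, w.IsClassGeneratedBy.{t} P := by
  rw [classNegative_iff] at hP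
  rw [localizing_eq] at htop
  have := hasCoproductsOfShape_nat.{t} (C := C)
  refine ⟨
    { le := closure (fun _ : Type t => True) (shifts (Set.Iic 0) P)
      ge := closure (fun _ : Type t => True) (shifts (Set.Ici 0) P)
      le_retract := ⟨closure_Iic_of_retract trivial⟩
      ge_retract := ⟨closure_Ici_of_retract trivial⟩
      le_shift := fun X hX => closure_Iic_shift (by simp) hX
      ge_shift := fun X hX => closure_Ici_shift zero_le_one hX
      orthogonal := fun X Y hX hY f => hP.orthogonal (m := 0) (n := 1) (by lia) hX
        (closure_shifts_shift (fun i hi => by simp only [Set.mem_Ici] at *; lia) hY) f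
      decomposition := fun M => ?_ }, isClassGeneratedBy_iff.2 ⟨inferInstance, rfl, rfl⟩⟩
  -- Here `B` has weights at least `1`; the definition requires it in the form `B'[1]`, whence the
  -- desuspension.
  obtain ⟨A, B, f, g, h, hT, hA, hB⟩ := hP.closure_le_extensionProduct 0 M (by rw [htop]; trivial)
  let e := (shiftFunctorCompIsoId C (-1 : ℤ) 1 (by simp)).app B
  refine ⟨A, B⟦(-1 : ℤ)⟧, f, g ≫ e.inv, e.hom ≫ h, hA,
    closure_shifts_shift (fun i hi => by simp only [Set.mem_Ici] at *; lia) hB, ?_⟩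
  exact distTriang_of_iso hT (Iso.refl _) (Iso.refl _) e.symm (by simp) (by simp) (by simp)

/-- Bounded objects belong to the localizing subcategory generated by the heart. -/
theorem bounded_le_closure [IsTriangulated C] (w : WeightStructure C) (K : Type t → Prop) :
    w.bounded ≤ closure K (shifts Set.univ w.heart) := by
  have hE := isClosedClass_closure K (shifts Set.univ w.heart)
  -- Induction on a bound for the weight range, peeling off the top weight: `B` is a shift by `j` of
  -- a heart object, and `A` has weights in `[i, j - 1]`. An empty range forces `X` to be zero.
  have key : ∀ (n : ℕ) (i j : ℤ), j < i + n → ∀ X, w.geInt i X → w.leInt j X →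
      closure K (shifts Set.univ w.heart) X := by
    intro n
    induction n with
    | zero =>
      intro i j hij X hge hle
      exact hE.zero _ ((IsZero.iff_id_eq_zero X).2
        (w.orthogonal_int (by simpa using hij) hle hge _))
    | succ n ih =>
      intro i j hij X hge hle
      obtain ⟨A, B, f, g, h, hT, hA, hB⟩ :
        ((w.leInt (j - 1)).extensionProduct (w.geInt j)) X := by
          have := w.decomposition_int (j - 1)
          rw [sub_add_cancel] at this
          rw [this]
          trivial
      have hBle : w.leInt j B := (w.isClosedClass_leInt (fun _ : Type => False) j).ext _
        (rot_of_distTriang _ hT) hle (w.leInt_shift hA (by lia))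
      have hBE : closure K (shifts Set.univ w.heart) B := by
        rw [leInt_iff] at hBle
        rw [geInt_iff] at hB
        exact le_closure _ _ _ ⟨j, trivial, _, ⟨hBle, hB⟩,
          ⟨((shiftFunctorCompIsoId C (-j) j (by simp)).app B).symm⟩⟩
      by_cases hij' : j ≤ i
      · by_cases hji : j < i
        · exact hE.zero _ ((IsZero.iff_id_eq_zero X).2 (w.orthogonal_int hji hle hge _))
        · obtain rfl : i = j := by lia
          rw [leInt_iff] at hle
          rw [geInt_iff] at hge
          exact le_closure _ _ _ ⟨i, trivial, _, ⟨hle, hge⟩,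
            ⟨((shiftFunctorCompIsoId C (-i) i (by simp)).app X).symm⟩⟩
      · have hAge : w.geInt i A := (w.isExtensionClosed_geInt i).ext _
          (inv_rot_of_distTriang _ hT)
          (w.geInt_mono (by lia) _ (w.geInt_shift hB (m := -1) rfl)) hge
        exact hE.mem hT (ih i (j - 1) (by push_cast at hij; lia) A hAge hA) hBE
  rintro X ⟨i, j, hi, hj⟩
  exact key (j - i + 1).toNat i j (by lia) X hi hj

/-- A smashing weight structure is class-generated by its heart if its bounded objects contain
generators of the category. -/
theorem IsSmashing.isClassGeneratedBy_heart [IsTriangulated C] [HasCoproducts.{t} C]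
    (hw : w.IsSmashing.{t}) {Q : ObjectProperty C} (hQ : localizing.{t} Q = ⊤)
    (hQw : Q ≤ w.bounded) : w.IsClassGeneratedBy.{t} w.heart := by
  have htop : localizing.{t} w.heart = ⊤ := by
    rw [localizing_eq] at *
    rw [eq_top_iff, ← hQ]
    refine closure_le (isClosedClass_closure _ _) ?_
    rintro X ⟨i, -, Y, hY, ⟨e⟩⟩
    exact prop_of_iso _ e.symm
      (closure_shifts_shift (by simp) (w.bounded_le_closure _ _ (hQw _ hY)))
  have hneg : ClassNegative.{t} w.heart :=
    (classNegative_iff _).2 (isNegative_of_le_heart (hw.isClosedClass _) le_rfl)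
  obtain ⟨w₀, hw₀⟩ := exists_isClassGeneratedBy hneg htop
  -- Both structures are smashing with hearts containing `w.heart`, so uniqueness identifies them.
  have h := hw₀.eq_of_isSmashing hw le_rfl
  subst h
  exact hw₀

/-- Elements of `Q` have weight at most `0` because the upper half is orthogonal to `Q[-1]`. The
vanishing above `k` says that `M[k]` is right orthogonal to the negative shifts of `Q`, so `M` has
weight at least `-k`. -/
theorem IsGeneratedBy.le_bounded {Q : ObjectProperty C} (hw : w.IsGeneratedBy Q)
    (h : ∀ M : C, Q M → ∃ iM : ℤ, ∀ i : ℤ, iM < i → ∀ X : C, Q X → ∀ f : X ⟶ M⟦i⟧, f = 0) :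
    Q ≤ w.bounded := by
  intro M hM
  obtain ⟨k, hk⟩ := h M hM
  refine ⟨-k, 0, ?_, ?_⟩
  · rw [geInt_iff, neg_neg, hw]
    rintro X f ⟨i, hi, Y, hY, ⟨e⟩⟩
    rw [← cancel_epi e.inv, comp_zero]
    refine eq_zero_of_shift_left (fun g => ?_) _
    let e' := (shiftFunctorAdd' C k (-i) (k - i) (by lia)).app M
    rw [← cancel_mono e'.inv, zero_comp]
    exact hk (k - i) (by simp only [Set.mem_Iio] at hi; lia) Y hY _
  · rw [leInt_zero, w.le_iff]
    intro Y hY f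
    rw [hw] at hY
    exact eq_zero_of_shift_right (fun g => hY g ⟨-1, by simp, M, hM, ⟨Iso.refl _⟩⟩) f

end WeightStructure

/-! ### Weight-exact functors and descent of class-generation. -/

section Functors

variable {D : Type u'} [Category.{v'} D] [HasZeroObject D] [HasShift D ℤ] [Preadditive D]
  [∀ n : ℤ, (shiftFunctor D n).Additive] [Pretriangulated D]

theorem IsClosedClass.inverseImage {K : Type t → Prop} {Q : ObjectProperty D}
    (hQ : IsClosedClass K Q) (F : C ⥤ D) [F.CommShift ℤ] [F.IsTriangulated]
    (hF : ∀ J : Type t, K J → PreservesColimitsOfShape (Discrete J) F) :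
    IsClosedClass K (Q.inverseImage F) where
  zero X hX := hQ.zero _ (F.map_isZero hX)
  ext T hT h1 h3 := hQ.ext _ (F.map_distinguished T hT) h1 h3
  coprod J hJ := by
    have := hQ.coprod J hJ
    have := hF J hJ
    infer_instance

theorem shifts_map {I : Set ℤ} {P : ObjectProperty C} {P' : ObjectProperty D} (F : C ⥤ D)
    [F.CommShift ℤ] (h : P ≤ P'.inverseImage F) : shifts I P ≤ (shifts I P').inverseImage F :=
  fun _ ⟨i, hi, Y, hY, ⟨e⟩⟩ => ⟨i, hi, _, h _ hY, ⟨F.mapIso e ≪≫ (F.commShiftIso i).app Y⟩⟩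

theorem closure_map {K : Type t → Prop} {I : Set ℤ} {P : ObjectProperty C}
    {P' : ObjectProperty D} (F : C ⥤ D) [F.CommShift ℤ] [F.IsTriangulated]
    (hF : ∀ J : Type t, K J → PreservesColimitsOfShape (Discrete J) F)
    (h : P ≤ P'.inverseImage F) :
    closure K (shifts I P) ≤ (closure K (shifts I P')).inverseImage F :=
  closure_le ((isClosedClass_closure _ _).inverseImage F hF)
    fun X hX => le_closure _ _ _ (shifts_map F h X hX)

namespace WeightStructure

variable {w : WeightStructure C} {v : WeightStructure D} {P : ObjectProperty C}
  {F : C ⥤ D} [F.CommShift ℤ] [F.IsTriangulated]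

/-- The preimage of `v.le` under `F` is a closed class. On the right-hand side the same argument
needs `v` smashing, since `v.ge` need not have coproducts otherwise. -/
theorem IsClassGeneratedBy.leftWeightExact_iff (hw : w.IsClassGeneratedBy.{t} P)
    (hF : RespectsCoproducts.{t} F) :
    w.LeftWeightExact v F ↔ ∀ X : C, P X → v.le (F.obj X) := by
  refine ⟨fun h X hX => h X (hw.le_heart X hX).1, fun h X hX => ?_⟩
  rw [(isClassGeneratedBy_iff.1 hw).2.2] at hX
  exact closure_shifts_le_le (P := v.le) _ le_rfl _
    (closure_map F (fun J _ => hF J) (fun X hX => h X hX) X hX)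

theorem IsClassGeneratedBy.rightWeightExact_iff (hw : w.IsClassGeneratedBy.{t} P)
    (hv : v.IsSmashing.{t}) (hF : RespectsCoproducts.{t} F) :
    w.RightWeightExact v F ↔ ∀ X : C, P X → v.ge (F.obj X) := by
  refine ⟨fun h X hX => h X (hw.le_heart X hX).2, fun h X hX => ?_⟩
  rw [(isClassGeneratedBy_iff.1 hw).2.1] at hX
  exact closure_shifts_le_ge (P := v.ge) (hv.isClosedClass _) le_rfl _
    (closure_map F (fun J _ => hF J) (fun X hX => h X hX) X hX)

/-- Lift a family to `C`, form its coproduct there, and apply `F`. -/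
theorem hasCoproducts_of_essSurj [HasCoproducts.{t} C] (hF : RespectsCoproducts.{t} F)
    [F.EssSurj] : HasCoproducts.{t} D := fun J => by
  have := hF J
  refine ⟨fun G => ?_⟩
  let G' : Discrete J ⥤ C := Discrete.functor fun j => F.objPreimage (G.obj ⟨j⟩)
  have : HasColimit (G' ⋙ F) :=
    ⟨⟨_, isColimitOfPreserves F (colimit.isColimit G')⟩⟩
  let e : G' ⋙ F ≅ G := Discrete.natIso fun j => F.objObjPreimageIso (G.obj j)
  exact hasColimit_of_iso e.symm

theorem exists_retract_of_le [F.EssSurj] (hge : w.RightWeightExact v F) {Y : D} (hY : v.le Y) :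
    ∃ A, w.le A ∧ Nonempty (Retract Y (F.obj A)) := by
  obtain ⟨A, B, f, g, h, hA, hB, hT⟩ := w.decomposition (F.objPreimage Y)
  let e := F.objObjPreimageIso Y
  have hT' : Triangle.mk (F.map f) (F.map g) _ ∈ distTriang D := F.map_distinguished _ hT
  obtain ⟨r⟩ := nonempty_retract_of_distTriang_left hT' (by
    have h0 := v.orthogonal hY (hge _ hB) (e.inv ≫ F.map g ≫ (F.commShiftIso (1 : ℤ)).hom.app B)
    rw [← cancel_epi e.inv, ← cancel_mono ((F.commShiftIso (1 : ℤ)).hom.app B), Category.assoc,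
      h0, comp_zero, zero_comp])
  exact ⟨A, hA, ⟨(Retract.ofIso e.symm).trans r⟩⟩

theorem exists_retract_of_ge [F.EssSurj] (hle : w.LeftWeightExact v F) {Y : D} (hY : v.ge Y) :
    ∃ B, w.ge B ∧ Nonempty (Retract Y (F.obj B)) := by
  obtain ⟨A, B, f, g, h, hT, hA, hB⟩ :
    ((w.leInt (-1)).extensionProduct (w.geInt 0)) (F.objPreimage Y) := by
      have := w.decomposition_int (-1)
      rw [neg_add_cancel] at this
      rw [this]
      trivial
  let e := F.objObjPreimageIso Y
  have hT' : Triangle.mk (F.map f) (F.map g) _ ∈ distTriang D := F.map_distinguished _ hT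
  obtain ⟨r⟩ := nonempty_retract_of_distTriang_right hT' (by
    have h0 := v.orthogonal_int (m := -1) (n := 0) (by lia)
      (shifts_map F (P' := v.le) (fun X hX => hle X hX) A hA) (by rwa [geInt_zero]) (F.map f ≫ e.hom)
    rw [← cancel_mono e.hom, h0, zero_comp])
  rw [geInt_zero] at hB
  exact ⟨B, hB, ⟨(Retract.ofIso e.symm).trans r⟩⟩

theorem IsClassGeneratedBy.map (hw : w.IsClassGeneratedBy.{t} P) (hF : RespectsCoproducts.{t} F)
    (hle : w.LeftWeightExact v F) (hge : w.RightWeightExact v F) [F.EssSurj] :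
    v.IsClassGeneratedBy.{t} (P.map F) := by
  have := hw.1
  have hD : HasCoproducts.{t} D := hasCoproducts_of_essSurj hF
  have := hasCoproductsOfShape_nat.{t} (C := D)
  have hPF : P ≤ (P.map F).inverseImage F := fun X hX => ⟨X, hX, ⟨Iso.refl _⟩⟩
  obtain ⟨-, hwge, hwle⟩ := isClassGeneratedBy_iff.1 hw
  have hheart : P.map F ≤ v.heart := by
    rintro Y ⟨X, hX, ⟨e⟩⟩
    exact ⟨v.le.prop_of_iso e (hle _ (hw.le_heart X hX).1),
      v.ge.prop_of_iso e (hge _ (hw.le_heart X hX).2)⟩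
  -- That `v` is smashing is derived: each `Y j` is a retract of some `F(B j)`, and `F` preserves
  -- the coproduct of the `B j`.
  have hv : IsSmashingClass.{t} v.ge := fun J => by
    refine isClosedUnderColimitsOfShape_discrete' fun Y hY => ?_
    choose B hB r using fun j => exists_retract_of_ge hle (hY j)
    have hpres := hF J
    have := hw.isSmashing.2 J
    let e : F.obj (∐ B) ≅ ∐ fun j => F.obj (B j) := PreservesCoproduct.iso F B
    refine prop_of_retract _ ⟨Limits.Sigma.map fun j => (r j).some.i,
      Limits.Sigma.map fun j => (r j).some.r, ?_⟩
      (v.ge.prop_of_iso e (hge _ (prop_sigma w.ge B hB)))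
    refine Limits.Sigma.hom_ext _ _ fun j => ?_
    simp
  refine isClassGeneratedBy_iff.2 ⟨hD, le_antisymm (fun Y hY => ?_) ?_,
    le_antisymm (fun Y hY => ?_) ?_⟩
  · obtain ⟨B, hB, ⟨r⟩⟩ := exists_retract_of_ge hle hY
    rw [hwge] at hB
    exact closure_Ici_of_retract trivial r (closure_map F (fun J _ => hF J) hPF _ hB)
  · exact closure_shifts_le_ge ⟨v.isExtensionClosed_ge, fun J _ => hv J⟩
      fun Y hY => (hheart Y hY).2
  · obtain ⟨A, hA, ⟨r⟩⟩ := exists_retract_of_le hge hY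
    rw [hwle] at hA
    exact closure_Iic_of_retract trivial r (closure_map F (fun J _ => hF J) hPF _ hA)
  · exact closure_shifts_le_le _ fun Y hY => (hheart Y hY).1

end WeightStructure

end Functors

end WeightTheory

namespace WeightTheory

variable {C : Type u} [Category.{v} C] [HasZeroObject C] [HasShift C ℤ] [Preadditive C]
  [∀ n : ℤ, (shiftFunctor C n).Additive] [Pretriangulated C]

open ObjectProperty

/-! ### Triangles, closures and weight structures in full subcategories. -/

section FullSubcategories

variable {E : ObjectProperty C} [E.IsTriangulated]

theorem exists_distTriang_fullSubcategory {X Y Z : E.FullSubcategory} {f : X.obj ⟶ Y.obj}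
    {g : Y.obj ⟶ Z.obj} {h : Z.obj ⟶ X.obj⟦(1 : ℤ)⟧}
    (hT : Triangle.mk f g h ∈ distTriang C) :
    ∃ (f' : X ⟶ Y) (g' : Y ⟶ Z) (h' : Z ⟶ X⟦(1 : ℤ)⟧),
      Triangle.mk f' g' h' ∈ distTriang E.FullSubcategory :=
  ⟨E.fullyFaithfulι.preimage f, E.fullyFaithfulι.preimage g,
    E.fullyFaithfulι.preimage (h ≫ (E.ι.commShiftIso (1 : ℤ)).inv.app X),
    distTriang_of_iso hT (Iso.refl _) (Iso.refl _) (Iso.refl _)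
      ((Category.comp_id _).trans (Category.id_comp _).symm)
      ((Category.comp_id _).trans (Category.id_comp _).symm) (by
        change h ≫ (𝟙 _)⟦(1 : ℤ)⟧' = 𝟙 _ ≫ (h ≫ (E.ι.commShiftIso (1 : ℤ)).inv.app X) ≫
          (E.ι.commShiftIso (1 : ℤ)).hom.app X
        rw [CategoryTheory.Functor.map_id, Category.comp_id, Category.id_comp, Category.assoc,
          Iso.inv_hom_id_app]
        exact (Category.comp_id _).symm)⟩

/-- This carries closed classes of the subcategory to closed classes of `C`, so that closure
induction in `C` can prove membership in closures formed inside `E`. -/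
theorem isClosedClass_fullSubcategory_image [E.IsClosedUnderIsomorphisms] {K : Type t → Prop}
    (hE : IsClosedClass K E) {Q : ObjectProperty E.FullSubcategory} (hQ : IsClosedClass K Q) :
    IsClosedClass K fun X => ∃ h : E X, Q ⟨X, h⟩ where
  zero X hX := ⟨hE.zero X hX, hQ.zero _ ((IsZero.iff_id_eq_zero _).2
    (E.ι.map_injective (hX.eq_of_src _ _)))⟩
  ext := by
    rintro T hT ⟨h1, hQ1⟩ ⟨h3, hQ3⟩
    have h2 := hE.ext T hT h1 h3
    obtain ⟨f, g, h, hT'⟩ := exists_distTriang_fullSubcategory (X := ⟨T.obj₁, h1⟩)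
      (Y := ⟨T.obj₂, h2⟩) (Z := ⟨T.obj₃, h3⟩) (f := T.mor₁) (g := T.mor₂) (h := T.mor₃) hT
    exact ⟨h2, hQ.mem hT' hQ1 hQ3⟩
  coprod J hJ := by
    refine isClosedUnderColimitsOfShape_discrete fun f c hc hf => ?_
    choose hfE hfQ using hf
    have := hE.coprod J hJ
    have := hQ.coprod J hJ
    have hcE : E c.pt := prop_of_isColimit_cofan E hc hfE
    refine ⟨hcE, prop_of_isColimit_cofan Q (f := fun j => ⟨f j, hfE j⟩)
      (c := Cofan.mk ⟨c.pt, hcE⟩ fun j => E.fullyFaithfulι.preimage (c.inj j)) ?_ hfQ⟩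
    refine Cofan.IsColimit.mk _ (fun s => E.fullyFaithfulι.preimage
      (Cofan.IsColimit.desc hc fun j => E.ι.map (s.inj j))) (fun s j => ?_) (fun s m hm => ?_)
    · apply E.ι.map_injective
      simp
    · apply E.ι.map_injective
      rw [Functor.FullyFaithful.map_preimage]
      refine Cofan.IsColimit.hom_ext hc _ _ fun j => ?_
      have := Cofan.IsColimit.fac hc (fun j => E.ι.map (s.inj j)) j
      rw [this, ← hm j, Functor.map_comp]
      simp

theorem preservesColimitsOfShape_ι [HasCoproducts.{t} C] {K : Type t → Prop}
    (hE : IsClosedClass K E) (J : Type t) (hJ : K J) :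
    PreservesColimitsOfShape (Discrete J) E.ι := by
  have := hE.coprod J hJ
  infer_instance

/-- Closures can be computed in a full triangulated subcategory. -/
theorem closure_inverseImage_ι [E.IsClosedUnderIsomorphisms] [HasCoproducts.{t} C]
    {K : Type t → Prop} (hE : IsClosedClass K E) {P : ObjectProperty C} (hP : P ≤ E) (I : Set ℤ) :
    closure K (shifts I (P.inverseImage E.ι)) = (closure K (shifts I P)).inverseImage E.ι := by
  apply le_antisymm
  · exact closure_map E.ι (preservesColimitsOfShape_ι hE) le_rfl
  · intro X hX
    have hQ := isClosedClass_closure K (shifts I (P.inverseImage E.ι))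
    obtain ⟨_, h⟩ := closure_le (isClosedClass_fullSubcategory_image hE hQ) (P := shifts I P) (by
      rintro Y ⟨i, hi, Z, hZ, ⟨e⟩⟩
      have hY : E Y := E.prop_of_iso e.symm (E.le_shift i _ (hP _ hZ))
      refine ⟨hY, le_closure _ _ _ ⟨i, hi, ⟨Z, hP _ hZ⟩, hZ, ⟨?_⟩⟩⟩
      exact E.fullyFaithfulι.preimageIso (e ≪≫ ((E.ι.commShiftIso i).app ⟨Z, hP _ hZ⟩).symm)) _ hX
    exact h

/-- Retract-closedness is asked only for retracts lying in `E`, which is all that is available for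
closures under finite coproducts. -/
theorem exists_weightStructure_fullSubcategory [E.IsClosedUnderIsomorphisms]
    {A B : ObjectProperty C} [A.IsClosedUnderIsomorphisms] [B.IsClosedUnderIsomorphisms]
    (hA : ∀ X M, E X → Retract X M → A M → A X) (hB : ∀ X M, E X → Retract X M → B M → B X)
    (hA' : ∀ X, A X → A (X⟦(-1 : ℤ)⟧)) (hB' : ∀ X, B X → B (X⟦(1 : ℤ)⟧))
    (orth : ∀ X Y, A X → B Y → ∀ f : X ⟶ Y⟦(1 : ℤ)⟧, f = 0)
    (dec : E ≤ (A ⊓ E).extensionProduct (shifts {1} (B ⊓ E))) :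
    ∃ w : WeightStructure E.FullSubcategory,
      w.le = A.inverseImage E.ι ∧ w.ge = B.inverseImage E.ι := by
  refine ⟨
    { le := A.inverseImage E.ι
      ge := B.inverseImage E.ι
      le_retract := ⟨fun {X Y} r hY => hA _ _ X.property (r.map E.ι) hY⟩
      ge_retract := ⟨fun {X Y} r hY => hB _ _ X.property (r.map E.ι) hY⟩
      le_shift := fun X hX =>
        A.prop_of_iso ((E.ι.commShiftIso (-1 : ℤ)).app X).symm (hA' _ hX)
      ge_shift := fun X hX =>
        B.prop_of_iso ((E.ι.commShiftIso (1 : ℤ)).app X).symm (hB' _ hX)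
      orthogonal := fun X Y hX hY f => ?_
      decomposition := fun M => ?_ }, rfl, rfl⟩
  · apply E.ι.map_injective
    rw [← cancel_mono ((E.ι.commShiftIso (1 : ℤ)).hom.app Y), Functor.map_zero, zero_comp]
    exact orth _ _ hX hY _
  · obtain ⟨X, Z, f, g, h, hT, ⟨hXA, hXE⟩, ⟨_, rfl, Y, ⟨hYB, hYE⟩, ⟨e⟩⟩⟩ := dec _ M.property
    have hZ : E Z := E.prop_of_iso e.symm (E.le_shift (1 : ℤ) _ hYE)
    obtain ⟨f', g', h', hT'⟩ := exists_distTriang_fullSubcategory (X := ⟨X, hXE⟩) (Y := M)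
      (Z := ⟨Z, hZ⟩) hT
    let e' : (⟨Z, hZ⟩ : E.FullSubcategory) ≅ (⟨Y, hYE⟩ : E.FullSubcategory)⟦(1 : ℤ)⟧ :=
      E.fullyFaithfulι.preimageIso (e ≪≫ ((E.ι.commShiftIso (1 : ℤ)).app ⟨Y, hYE⟩).symm)
    exact ⟨_, _, f', g' ≫ e'.hom, e'.inv ≫ h', hXA, hYB,
      distTriang_of_iso hT' (Iso.refl _) (Iso.refl _) e' (by simp) (by simp) (by simp)⟩

end FullSubcategories

/-! ### Weight structures on generated subcategories and restriction. -/

section GeneratedSubcategories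

variable {K : Type t → Prop} {P : ObjectProperty C}

theorem isTriangulated_closure (K : Type t → Prop) (P : ObjectProperty C) :
    (closure K (shifts Set.univ P)).IsTriangulated :=
  have h := isClosedClass_closure K (shifts Set.univ P)
  { toContainsZero := h.containsZero
    isStableUnderShiftBy := fun _ => ⟨fun _ hX => closure_shifts_shift (by simp) hX⟩
    toIsTriangulatedClosed₂ := .mk' h.ext }

theorem le_closure_shifts_univ (K : Type t → Prop) (P : ObjectProperty C) :
    P ≤ closure K (shifts Set.univ P) :=
  (le_shifts (Set.mem_univ _) P).trans (le_closure _ _)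

theorem IsNegative.exists_decomposition [IsTriangulated C] [HasCoproducts.{t} C]
    (hP : IsNegative K P) :
    closure K (shifts Set.univ P) ≤
      (closure K (shifts (Set.Iic 0) P) ⊓ closure K (shifts Set.univ P)).extensionProduct
        (shifts {1} (closure K (shifts (Set.Ici 0) P) ⊓ closure K (shifts Set.univ P))) := by
  refine (hP.closure_le_extensionProduct 0).trans (extensionProduct_mono ?_ ?_)
  · exact fun X hX => ⟨hX, closure_mono (fun _ => id) (shifts_mono (Set.subset_univ _) le_rfl) _ hX⟩
  · intro X hX
    have h1 : closure K (shifts (Set.Ici 0) P) (X⟦(-1 : ℤ)⟧) :=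
      closure_shifts_shift (fun i hi => by simp only [Set.mem_Ici] at *; lia) hX
    exact ⟨1, rfl, _,
      ⟨h1, closure_mono (fun _ => id) (shifts_mono (Set.subset_univ _) le_rfl) _ h1⟩,
      ⟨((shiftFunctorCompIsoId C (-1 : ℤ) 1 (by simp)).app X).symm⟩⟩

/-- The weight structure on the subcategory generated by a negative class. -/
theorem IsNegative.exists_weightStructure [IsTriangulated C] [HasCoproducts.{t} C]
    (hP : IsNegative K P) (hK : K (ULift.{t} ℕ) ∨ ∀ J, K J → Finite J)
    [(closure K (shifts Set.univ P)).IsTriangulated] :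
    ∃ w : WeightStructure (closure K (shifts Set.univ P)).FullSubcategory,
      w.le = (closure K (shifts (Set.Iic 0) P)).inverseImage
        (closure K (shifts Set.univ P)).ι ∧
      w.ge = (closure K (shifts (Set.Ici 0) P)).inverseImage
        (closure K (shifts Set.univ P)).ι := by
  have := hasCoproductsOfShape_nat.{t} (C := C)
  refine exists_weightStructure_fullSubcategory (fun X M hX r hM => ?_) (fun X M hX r hM => ?_)
    (fun X hX => closure_Iic_shift (by simp) hX) (fun X hX => closure_Ici_shift zero_le_one hX)
    (fun X Y hX hY f => hP.orthogonal (m := 0) (n := 1) (by lia) hX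
      (closure_shifts_shift (fun i hi => by simp only [Set.mem_Ici] at *; lia) hY) f)
    hP.exists_decomposition
  · rcases hK with hK | hK
    · exact closure_Iic_of_retract hK r hM
    · exact closure_Iic_of_retract_of_finite hK hX r hM
  · rcases hK with hK | hK
    · exact closure_Ici_of_retract hK r hM
    · exact closure_Ici_of_retract_of_finite hK hX r hM

theorem hasCoproductsOfShape_closure [HasCoproducts.{t} C] (P : ObjectProperty C) {J : Type t}
    (hJ : K J) : HasCoproductsOfShape J (closure K P).FullSubcategory := by
  have := (isClosedClass_closure K P).coprod J hJ
  infer_instance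

/-- Class-negative classes give weight structures on localizing subcategories. -/
theorem exists_isClassGeneratedBy_localizing [IsTriangulated C] [HasCoproducts.{t} C]
    (hP : ClassNegative.{t} P) :
    (localizing.{t} P).IsStableUnderRetracts ∧
      ∃ _ : (localizing.{t} P).IsTriangulated,
        ∃ w : WeightStructure (localizing.{t} P).FullSubcategory,
          w.IsClassGeneratedBy.{t} (P.inverseImage (localizing.{t} P).ι) := by
  rw [classNegative_iff] at hP
  rw [WeightStructure.localizing_eq]
  have hE := isClosedClass_closure (fun _ : Type t => True) (shifts Set.univ P)
  have := hasCoproductsOfShape_nat.{t} (C := C)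
  refine ⟨⟨fun r hM => hE.of_retract_of_nat (hE.isClosedUnderColimitsOfShape_nat trivial)
    (Or.inl rfl) (fun _ hY => closure_shifts_shift (by simp) hY) r hM⟩,
    isTriangulated_closure _ P, ?_⟩
  have := isTriangulated_closure (fun _ : Type t => True) P
  obtain ⟨w, hle, hge⟩ := hP.exists_weightStructure (Or.inl trivial)
  refine ⟨w, WeightStructure.isClassGeneratedBy_iff.2
    ⟨fun J => hasCoproductsOfShape_closure _ trivial, ?_, ?_⟩⟩
  · rw [hge, closure_inverseImage_ι hE (le_closure_shifts_univ _ P)]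
  · rw [hle, closure_inverseImage_ι hE (le_closure_shifts_univ _ P)]

namespace WeightStructure

variable {w : WeightStructure C}

/-- The inclusions suffice: an object of `E` in `w.le` is orthogonal to `v.ge[1]`, hence lies in
`v.le`, and dually. -/
theorem isRestriction_of_eq_inverseImage
    {E : ObjectProperty C} [E.IsTriangulated] {v : WeightStructure E.FullSubcategory}
    {A B : ObjectProperty C} (hle : v.le = A.inverseImage E.ι) (hge : v.ge = B.inverseImage E.ι)
    (hA : A ≤ w.le) (hB : B ≤ w.ge) : w.IsRestriction E v := by
  constructor
  · refine le_antisymm (by rw [hle]; exact fun X hX => hA _ hX) fun X hX => ?_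
    rw [v.le_iff]
    intro Y hY f
    rw [hge] at hY
    apply E.ι.map_injective
    rw [← cancel_mono ((E.ι.commShiftIso (1 : ℤ)).hom.app Y), Functor.map_zero, zero_comp]
    exact w.orthogonal hX (hB _ hY) _
  · refine le_antisymm (by rw [hge]; exact fun X hX => hB _ hX) fun Y hY => ?_
    rw [v.ge_iff]
    intro X hX f
    rw [hle] at hX
    apply E.ι.map_injective
    rw [← cancel_mono ((E.ι.commShiftIso (1 : ℤ)).hom.app Y), Functor.map_zero, zero_comp]
    exact w.orthogonal (hA _ hX) hY _

theorem cardLocalizing_eq (α : Cardinal.{t}) (P : ObjectProperty C) :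
    cardLocalizing α P = closure (fun J : Type t => Cardinal.mk J < α) (shifts Set.univ P) :=
  cardSmashingClosure_eq _ _

/-- Restriction of a class-generated weight structure to `α`-localizing subcategories. -/
theorem IsClassGeneratedBy.exists_isRestriction_cardLocalizing [IsTriangulated C]
    (hw : w.IsClassGeneratedBy.{t} P) {α : Cardinal.{t}} (hα : α.IsRegular) :
    ∃ _ : (cardLocalizing α P).IsTriangulated,
      ∃ wα : WeightStructure (cardLocalizing α P).FullSubcategory,
        w.IsRestriction (cardLocalizing α P) wα ∧ wα.IsCardSmashing α ∧
        wα.IsCardGeneratedBy α (P.inverseImage (cardLocalizing α P).ι) := by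
  have := hw.1
  rw [cardLocalizing_eq]
  refine ⟨isTriangulated_closure _ P, ?_⟩
  have := isTriangulated_closure (fun J : Type t => Cardinal.mk J < α) P
  have hcl := hw.isSmashing.isClosedClass (fun J : Type t => Cardinal.mk J < α)
  have hE := isClosedClass_closure (fun J : Type t => Cardinal.mk J < α) (shifts Set.univ P)
  obtain ⟨v, hle, hge⟩ := (hw.isNegative fun J : Type t => Cardinal.mk J < α).exists_weightStructure
    (by
      -- For `α > ℵ₀` countable coproducts are allowed and the swindle applies; for `α = ℵ₀` all
      -- index types are finite.
      rcases hα.aleph0_le.lt_or_eq with h | h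
      · exact Or.inl (by simpa using h)
      · exact Or.inr fun J hJ => Cardinal.mk_lt_aleph0_iff.1 (h ▸ hJ))
  have hcat : IsCardSmashingCategory α
      (closure (fun J : Type t => Cardinal.mk J < α) (shifts Set.univ P)).FullSubcategory :=
    fun J hJ => hasCoproductsOfShape_closure (K := fun J : Type t => Cardinal.mk J < α) _ hJ
  refine ⟨v, isRestriction_of_eq_inverseImage hle hge
    (closure_shifts_le_le _ fun X hX => (hw.le_heart X hX).1)
    (closure_shifts_le_ge hcl fun X hX => (hw.le_heart X hX).2), ⟨hcat, ?_⟩, hcat, ?_, ?_⟩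
  · rw [hge]
    exact ((isClosedClass_closure _ _).inverseImage _ (preservesColimitsOfShape_ι hE)).coprod
  · rw [hge, cardSmashingClosure_eq, closure_inverseImage_ι hE (le_closure_shifts_univ _ P)]
  · rw [hle, cardSmashingClosure_eq, closure_inverseImage_ι hE (le_closure_shifts_univ _ P)]

theorem cardLocalizing_mono {α β : Cardinal.{t}} (h : α ≤ β) (P : ObjectProperty C) :
    cardLocalizing α P ≤ cardLocalizing β P := by
  rw [cardLocalizing_eq, cardLocalizing_eq]
  exact closure_mono (fun J hJ => lt_of_lt_of_le hJ h) le_rfl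

theorem isTriangulated_cardLocalizing (α : Cardinal.{t}) (P : ObjectProperty C) :
    (cardLocalizing α P).IsTriangulated := by
  rw [cardLocalizing_eq]
  exact isTriangulated_closure _ P

/-- The levels form a chain, so the outer terms of a triangle lie in a common level. -/
theorem isExtensionClosed_cardLocalizingUnion {β : Cardinal.{t}} (hβ : Cardinal.aleph0 ≤ β)
    (P : ObjectProperty C) : IsExtensionClosed (cardLocalizingUnion β P) := by
  have hE : ∀ γ, IsExtensionClosed (cardLocalizing γ P) := fun γ => by
    rw [cardLocalizing_eq]
    exact (isClosedClass_closure _ _).1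
  refine ⟨fun X hX => ⟨_, Cardinal.isRegular_aleph0, hβ, (hE _).zero X hX⟩, ?_⟩
  rintro T hT ⟨γ, hγ, hγβ, h1⟩ ⟨δ, hδ, hδβ, h3⟩
  rcases le_total γ δ with h | h
  · exact ⟨δ, hδ, hδβ, (hE δ).ext T hT (cardLocalizing_mono h P _ h1) h3⟩
  · exact ⟨γ, hγ, hγβ, (hE γ).ext T hT h1 (cardLocalizing_mono h P _ h3)⟩

/-- Restriction of a class-generated weight structure to the union of the `γ`-localizing
subcategories for `γ ≤ β`. -/
theorem IsClassGeneratedBy.exists_isRestriction_cardLocalizingUnion [IsTriangulated C]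
    (hw : w.IsClassGeneratedBy.{t} P) {β : Cardinal.{t}} (hβ : Cardinal.aleph0 ≤ β) :
    ∃ _ : (cardLocalizingUnion β P).IsTriangulated,
      ∃ wβ : WeightStructure (cardLocalizingUnion β P).FullSubcategory,
        w.IsRestriction (cardLocalizingUnion β P) wβ := by
  have := hw.1
  have hE := isExtensionClosed_cardLocalizingUnion hβ P
  have htri : (cardLocalizingUnion β P).IsTriangulated :=
    { toContainsZero := hE.containsZero
      isStableUnderShiftBy := fun n => ⟨fun X ⟨γ, hγ, hγβ, hX⟩ =>
        have := isTriangulated_cardLocalizing γ P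
        ⟨γ, hγ, hγβ, (cardLocalizing γ P).le_shift n _ hX⟩⟩
      toIsTriangulatedClosed₂ :=
        have := hE.isClosedUnderIsomorphisms
        .mk' hE.ext }
  have := hE.isClosedUnderIsomorphisms
  refine ⟨htri, exists_weightStructure_fullSubcategory (E := cardLocalizingUnion β P)
    (fun X M _ r hM => prop_of_retract w.le r hM) (fun X M _ r hM => prop_of_retract w.ge r hM)
    w.le_shift w.ge_shift (fun X Y hX hY f => w.orthogonal hX hY f) ?_⟩
  -- The decomposition of `X` is taken inside the level `γ` that contains it.
  rintro X ⟨γ, hγ, hγβ, hX⟩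
  have hcl := hw.isSmashing.isClosedClass (fun J : Type t => Cardinal.mk J < γ)
  have hle : closure (fun J : Type t => Cardinal.mk J < γ) (shifts Set.univ P) ≤
      cardLocalizingUnion β P := by
    rw [← cardLocalizing_eq]
    exact fun Y hY => ⟨γ, hγ, hγβ, hY⟩
  rw [cardLocalizing_eq] at hX
  refine extensionProduct_mono (inf_le_inf ?_ hle) (shifts_mono le_rfl (inf_le_inf ?_ hle)) X
    ((hw.isNegative fun J : Type t => Cardinal.mk J < γ).exists_decomposition X hX)
  · exact closure_shifts_le_le _ fun X hX => (hw.le_heart X hX).1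
  · exact closure_shifts_le_ge hcl fun X hX => (hw.le_heart X hX).2

end WeightStructure

end GeneratedSubcategories

end WeightTheory

/-! ### Assembly of the statement. -/

theorem corollary2p3p1 {C : Type u} [Category.{v} C] [HasZeroObject C] [HasShift C ℤ]
    [Preadditive C] [∀ n : ℤ, (shiftFunctor C n).Additive] [Pretriangulated C]
    [IsTriangulated C] [HasCoproducts.{t} C] :
    -- Existence on the localizing subcategory generated by a class-negative class.
    (∀ P : ObjectProperty C, ClassNegative.{t} P →
      (localizing.{t} P).IsStableUnderRetracts ∧
      ∃ _ : (localizing.{t} P).IsTriangulated,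
        ∃ w : WeightStructure (localizing.{t} P).FullSubcategory,
          w.IsSmashing.{t} ∧
          w.IsClassGeneratedBy.{t} (P.inverseImage (localizing.{t} P).ι)) ∧
    -- Existence on `C` itself, with the uniqueness and the heart.
    (∀ P : ObjectProperty C, ClassNegative.{t} P → localizing.{t} P = ⊤ →
      ∃ w : WeightStructure C,
        w.IsSmashing.{t} ∧ w.IsClassGeneratedBy.{t} P ∧ w.IsGeneratedBy P ∧ P ≤ w.heart ∧
        (∀ w' : WeightStructure C, w'.IsSmashing.{t} → P ≤ w'.heart → w' = w) ∧
        w.heart = (coproductsOf.{t} P).retractClosure) ∧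
    -- Properties of any class-generated weight structure.
    (∀ (P : ObjectProperty C) (w : WeightStructure C), w.IsClassGeneratedBy.{t} P →
      ClassNegative.{t} P ∧ localizing.{t} P = ⊤ ∧ w.IsSmashing.{t} ∧
      w.IsLeftNondegenerate ∧ w.IsGeneratedBy P ∧
      w.heart = (coproductsOf.{t} P).retractClosure ∧
      (∀ w' : WeightStructure C, w'.IsSmashing.{t} → P ≤ w'.heart → w' = w) ∧
      -- Weight-exactness and descent of generation.
      (∀ (D : Type u') [Category.{v'} D] [HasZeroObject D] [HasShift D ℤ] [Preadditive D]
        [∀ n : ℤ, (shiftFunctor D n).Additive] [Pretriangulated D] [IsTriangulated D]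
        (v : WeightStructure D) (F : C ⥤ D) [F.CommShift ℤ] [F.IsTriangulated],
        RespectsCoproducts.{t} F →
          (w.LeftWeightExact v F ↔ ∀ X : C, P X → v.le (F.obj X)) ∧
          (v.IsSmashing.{t} →
            (w.RightWeightExact v F ↔ ∀ X : C, P X → v.ge (F.obj X))) ∧
          (w.LeftWeightExact v F → w.RightWeightExact v F → F.EssSurj →
            v.IsClassGeneratedBy.{t} (P.map F))) ∧
      -- Restrictions to the `α`-localizing subcategories, for all infinite regular `α`.
      (∀ α : Cardinal.{t}, α.IsRegular →
        ∃ _ : (cardLocalizing α P).IsTriangulated,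
          ∃ wα : WeightStructure (cardLocalizing α P).FullSubcategory,
            w.IsRestriction (cardLocalizing α P) wα ∧ wα.IsCardSmashing α ∧
            wα.IsCardGeneratedBy α (P.inverseImage (cardLocalizing α P).ι)) ∧
      -- Restrictions to the levels for arbitrary infinite cardinals.
      (∀ β : Cardinal.{t}, Cardinal.aleph0 ≤ β →
        ∃ _ : (cardLocalizingUnion β P).IsTriangulated,
          ∃ wβ : WeightStructure (cardLocalizingUnion β P).FullSubcategory,
            w.IsRestriction (cardLocalizingUnion β P) wβ)) ∧
    -- Class-negativity versus countable negativity.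
    (∀ P : ObjectProperty C,
      ClassNegative.{t} P ↔ CountablyNegative.{t} (coproductsOf.{t} P)) ∧
    -- Criteria for a smashing weight structure to be class-generated by its heart.
    (∀ w : WeightStructure C, w.IsSmashing.{t} →
      ∀ Q : ObjectProperty C, localizing.{t} Q = ⊤ →
        (Q ≤ w.bounded → w.IsClassGeneratedBy.{t} w.heart) ∧
        (w.IsGeneratedBy Q →
          (∀ M : C, Q M → ∃ iM : ℤ, ∀ i : ℤ, iM < i →
            ∀ X : C, Q X → ∀ f : X ⟶ M⟦i⟧, f = 0) →
          w.IsClassGeneratedBy.{t} w.heart)) := by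
  refine ⟨fun P hP => ?_, fun P hP htop => ?_, fun P w hw => ?_,
    fun P => classNegative_iff_countablyNegative P,
    fun w hw Q hQ => ⟨fun h => hw.isClassGeneratedBy_heart hQ h,
      fun hgen h => hw.isClassGeneratedBy_heart hQ (hgen.le_bounded h)⟩⟩
  · obtain ⟨hr, ht, w, hw⟩ := exists_isClassGeneratedBy_localizing hP
    exact ⟨hr, ht, w, hw.isSmashing, hw⟩
  · obtain ⟨w, hw⟩ := WeightStructure.exists_isClassGeneratedBy hP htop
    exact ⟨w, hw.isSmashing, hw, hw.isGeneratedBy, hw.le_heart,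
      fun w' h h' => hw.eq_of_isSmashing h h', hw.heart_eq⟩
  · refine ⟨(classNegative_iff P).2 (hw.isNegative _), hw.localizing_eq_top, hw.isSmashing,
      hw.isLeftNondegenerate, hw.isGeneratedBy, hw.heart_eq,
      fun w' h h' => hw.eq_of_isSmashing h h', ?_,
      fun α hα => hw.exists_isRestriction_cardLocalizing hα,
      fun β hβ => hw.exists_isRestriction_cardLocalizingUnion hβ⟩
    intro D _ _ _ _ _ _ _ v F _ _ hF
    exact ⟨hw.leftWeightExact_iff hF, fun hv => hw.rightWeightExact_iff hv hF,
      fun hle hge _ => hw.map hF hle hge⟩
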